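/- Let $\mathbb{D}$ be the open unit disk, $\mathbb{T}$ the unit circle, $m$ normalized Lebesgue measure on $\mathbb{T}$, and $n\ge 1$. Let $p(z_1,z_2)=p_1(z_1)+z_2p_2(z_1)$ with $p_1,p_2\in\mathbb{C}[z]$ of degree at most $n$, assume that $p$ has no zeros in $\mathbb{D}^2$, and put $\tilde p_i(z)=z^n\overline{p_i(1/\bar z)}$ and $\tilde p(z_1,z_2)=z_2\tilde p_1(z_1)+\tilde p_2(z_1)$. Assume that $p$ and $\tilde p$ have no common factor, so that $\phi=\tilde p/p$ is a rational inner function of degree $(n,1)$ on $\mathbb{D}^2$. Let $\alpha\in\mathbb{T}$. The polynomial $p$ has finitely many zeros $(\tau_1,\lambda_1),\dots,(\tau_M,\lambda_M)$ on $\mathbb{T}^2$ (listed without repetition), with $0\le M\le n$, and at each of them the non-tangential value $\phi^*(\tau_k,\lambda_k)$ exists and is unimodular. Define $$B_\alpha=\frac{\tilde p_1-\alpha p_2}{\alpha p_1-\tilde p_2}\quad\text{(common factors cancelled)},\qquad W_\alpha(\zeta)=\frac{|p_1(\zeta)|^2-|p_2(\zeta)|^2}{|\tilde p_1(\zeta)-\alpha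 p_2(\zeta)|^2}\quad(\zeta\in\mathbb{T}),\qquad d\nu_\alpha=W_\alpha\,dm .$$ Then $B_\alpha$ is a finite Blaschke product (possibly constant) and $W_\alpha\ge 0$ (with $W_\alpha$ set to $0$ at the finitely many points where its denominator vanishes). There is a unique finite positive Borel measure $\sigma_\alpha$ on $\mathbb{T}^2$ (the Clark measure) such that for all $z\in\mathbb{D}^2$ $$\operatorname{Re}\frac{\alpha+\phi(z)}{\alpha-\phi(z)}=\int_{\mathbb{T}^2}\frac{(1-|z_1|^2)(1-|z_2|^2)}{|\zeta_1-z_1|^2|\zeta_2-z_2|^2}\,d\sigma_\alpha(\zeta).$$ Moreover there are constants $c_1^\alpha,\dots,c_M^\alpha\ge 0$ such that for every $f\in L^1(\sigma_\alpha)$ $$\int_{\mathbb{T}^2} f\,d\sigma_\alpha=\int_{\mathbb{T}} f\big(\zeta,\overline{B_\alpha(\zeta)}\big)\,d\nu_\alpha(\zeta)+\sum_{k=1}^{M}c_k^\alpha\int_{\mathbb{T}}f(\tau_k,\zeta)\,dm(\zeta),$$ where the first integral on the right converges absolutely, the integral in the $k$-th term converges absolutely whenever $c_k^\alpha>0$,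 and terms with $c_k^\alpha=0$ are omitted. For each $k$, $c_k^\alpha>0$ if and only if $\phi^*(\tau_k,\lambda_k)=\alpha$, and in that case $$c_k^\alpha=\frac{1}{\left|\frac{\partial\phi}{\partial z_1}(\tau_k,z_2)\right|}\qquad\text{for every } z_2\in\overline{\mathbb{D}}\setminus\{\lambda_k\}.$$ -/

import Mathlib

open MeasureTheory Filter Topology Polynomial
open scoped Polynomial.Bivariate ComplexConjugate

noncomputable section

namespace ClarkRIF

/-- The Borel σ-algebra on the unit circle `𝕋`. -/
instance circleMeasurableSpace : MeasurableSpace Circle := borel Circle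

instance circleBorelSpace : BorelSpace Circle := ⟨rfl⟩

/-- Normalized Lebesgue measure on the unit circle: the image of `dθ / (2π)` on `(0, 2π]` under
`θ ↦ exp (iθ)`. -/
def circleMeasure : Measure Circle :=
  ENNReal.ofReal (2 * Real.pi)⁻¹ •
    (volume.restrict (Set.Ioc (0 : ℝ) (2 * Real.pi))).map Circle.exp

/-- The Poisson kernel of the bidisk. -/
def poissonKernel (z : ℂ × ℂ) (ζ : Circle × Circle) : ℝ :=
  ((1 - ‖z.1‖ ^ 2) * (1 - ‖z.2‖ ^ 2)) /
    (‖(ζ.1 : ℂ) - z.1‖ ^ 2 * ‖(ζ.2 : ℂ) - z.2‖ ^ 2)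

/-- `σ` is a Clark measure of `φ` at `α`: a finite positive Borel measure on `𝕋²` whose Poisson
integral is `Re ((α + φ) / (α - φ))` on the bidisk. -/
def IsClarkMeasure (φ : ℂ × ℂ → ℂ) (α : Circle) (σ : Measure (Circle × Circle)) : Prop :=
  IsFiniteMeasure σ ∧
    ∀ z : ℂ × ℂ, ‖z.1‖ < 1 → ‖z.2‖ < 1 →
      (((α : ℂ) + φ z) / ((α : ℂ) - φ z)).re = ∫ ζ, poissonKernel z ζ ∂σ

/-- The product of two Stolz angles of aperture `M` with vertices `ζ.1` and `ζ.2`. For `M > 0` it is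
contained in the open bidisk. -/
def stolzRegion (M : ℝ) (ζ : Circle × Circle) : Set (ℂ × ℂ) :=
  {z | ‖z.1 - (ζ.1 : ℂ)‖ < M * (1 - ‖z.1‖) ∧ ‖z.2 - (ζ.2 : ℂ)‖ < M * (1 - ‖z.2‖)}

/-- `φ*(ζ)` exists and equals `β`, where `φ*` is the non-tangential boundary value. -/
def HasNontangentialValue (φ : ℂ × ℂ → ℂ) (ζ : Circle × Circle) (β : ℂ) : Prop :=
  ∀ M : ℝ, 1 < M → Tendsto φ (𝓝[stolzRegion M ζ] ((ζ.1 : ℂ), (ζ.2 : ℂ))) (𝓝 β)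

/-- The one-variable reflection `q̃(z) = z ^ n * conj (q (1 / conj z))` of a polynomial of degree at
most `n`: the coefficient of `z ^ i` is the conjugate of the coefficient of `z ^ (n - i)` in `q`. -/
def reflection (n : ℕ) (q : ℂ[X]) : ℂ[X] :=
  (q.map (starRingEnd ℂ)).reflect n

/-- The `(n, 1)`-reflection `p̃ = p̃₂(z₁) + z₂ p̃₁(z₁)` of `p = p₁(z₁) + z₂ p₂(z₁)`. In `ℂ[X][Y]` the
inner variable `X` is `z₁` and the outer variable `Y` is `z₂`, so `p₁ = p.coeff 0` and
`p₂ = p.coeff 1`. -/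
def biReflection (n : ℕ) (p : ℂ[X][Y]) : ℂ[X][Y] :=
  C (reflection n (p.coeff 1)) + X * C (reflection n (p.coeff 0))

/-- `p` is the denominator of a rational inner function `p̃ / p` of degree `(n, 1)`: it has degree at
most `(n, 1)`, has no zeros in the open bidisk and has no common factor with its
`(n, 1)`-reflection `p̃`. As `p (0, 0) ≠ 0`, the degree of `p̃` is then exactly `(n, 1)`. -/
structure IsRIFDenominator (n : ℕ) (p : ℂ[X][Y]) : Prop where
  natDegree_coeff_le : ∀ j, (p.coeff j).natDegree ≤ n
  natDegree_le : p.natDegree ≤ 1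
  evalEval_ne_zero : ∀ z₁ z₂ : ℂ, ‖z₁‖ < 1 → ‖z₂‖ < 1 → p.evalEval z₁ z₂ ≠ 0
  isRelPrime : IsRelPrime p (biReflection n p)

/-- The rational inner function `φ = p̃ / p`. -/
def rif (n : ℕ) (p : ℂ[X][Y]) (z : ℂ × ℂ) : ℂ :=
  (biReflection n p).evalEval z.1 z.2 / p.evalEval z.1 z.2

/-- The zeros of `p` on `𝕋²`, i.e. the boundary singularities of `p̃ / p`. -/
def boundaryZeros (p : ℂ[X][Y]) : Set (Circle × Circle) :=
  {ζ | p.evalEval (ζ.1 : ℂ) (ζ.2 : ℂ) = 0}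

/-- The rational function `B_α = (p̃₁ - α p₂) / (α p₁ - p̃₂)`. As an element of `RatFunc ℂ` it is
evaluated (by `RatFunc.eval`) in lowest terms, after cancelling common factors. -/
def bAlpha (n : ℕ) (p : ℂ[X][Y]) (α : Circle) : RatFunc ℂ :=
  algebraMap ℂ[X] (RatFunc ℂ) (reflection n (p.coeff 0) - C (α : ℂ) * p.coeff 1) /
    algebraMap ℂ[X] (RatFunc ℂ) (C (α : ℂ) * p.coeff 0 - reflection n (p.coeff 1))

/-- A finite Blaschke product `γ ∏ (z - a_j) / (1 - conj a_j z)`, with `|γ| = 1` and `|a_j| < 1`. -/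
def IsFiniteBlaschkeProduct (B : RatFunc ℂ) : Prop :=
  ∃ (γ : Circle) (d : ℕ) (a : Fin d → ℂ), (∀ j, ‖a j‖ < 1) ∧
    B = RatFunc.C (γ : ℂ) *
      ∏ j, (RatFunc.X - RatFunc.C (a j)) / (1 - RatFunc.C (conj (a j)) * RatFunc.X)

/-- The weight `W_α = (|p₁|² - |p₂|²) / |p̃₁ - α p₂|²` on `𝕋`. -/
def wAlpha (n : ℕ) (p : ℂ[X][Y]) (α ζ : Circle) : ℝ :=
  (‖(p.coeff 0).eval (ζ : ℂ)‖ ^ 2 - ‖(p.coeff 1).eval (ζ : ℂ)‖ ^ 2) /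
    ‖(reflection n (p.coeff 0)).eval (ζ : ℂ) - (α : ℂ) * (p.coeff 1).eval (ζ : ℂ)‖ ^ 2

/-- The measure `dν_α = W_α dm` on `𝕋`. -/
def nuAlpha (n : ℕ) (p : ℂ[X][Y]) (α : Circle) : Measure Circle :=
  circleMeasure.withDensity fun ζ => ENNReal.ofReal (wAlpha n p α ζ)

end ClarkRIF

end

noncomputable section

namespace ClarkRIF

/-! Put `N = p̃₁ - α p₂` and `D = α p₁ - p̃₂`, so that `α p - p̃ = D - z₂ N` and `B_α = N / D`. Up
to the factor `α`, `D` is the reflection of `N`, and it has no zero in the open disk. Hence all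
roots of `N` lie in the closed disk; those on the circle cancel against `D`, and the others form a
Blaschke product.

Fix `z₂` in the disk. As a function of `z₁`, `(α + φ) / (α - φ)` is a rational function. Its real
part on the circle is, almost everywhere, `W_α` times the Poisson kernel of `z₂` at the conjugate of
`B_α`. Its only poles in the closed disk are the zeros of `D` on the circle, which are the first
coordinates of the singularities with `φ* = α`. At such a `τ` the `z₁`-derivative of `φ` has a
modulus `s > 0` that does not depend on `z₂`, so the pole is simple and contributes `s⁻¹` times a
Poisson kernel in `z₁`. Removing the poles and applying the Poisson formula
(`poisson_formula_of_simple_poles`, `poisson_formula_rif`) gives the representation: as `s⁻¹` is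
free of `z₂` and the kernel of `z₂` has mean one, each pole becomes a multiple of Lebesgue measure
on `{τ} × 𝕋` (`isClarkMeasure_graphMeasure`).

The singularities are governed by `defect`, of degree at most `2n`. On the circle it is `ζ ^ n`
times a nonnegative function, so its zeros there are at least double and number at most `n`. At each
of them the Schwarz-Pick lemma for `p̃₂ / p₁` gives a positive angular derivative
(`exists_isSingularity`), which yields both the non-tangential value and the derivative formula.
Uniqueness holds because the Poisson integral determines the Fourier coefficients
(`integral_zpow_mul_zpow`). -/

/-! ### Reflection of polynomials. -/

theorem natDegree_reflection_le {n : ℕ} {q : ℂ[X]} (hq : q.natDegree ≤ n) :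
    (reflection n q).natDegree ≤ n := by
  refine natDegree_reflect_le.trans ?_
  simpa using hq

theorem reflection_reflection (n : ℕ) (q : ℂ[X]) : reflection n (reflection n q) = q := by
  unfold reflection
  rw [← reflect_map, reflect_reflect, Polynomial.map_map]
  convert Polynomial.map_id
  ext z
  simp

theorem reflection_sub (n : ℕ) (q r : ℂ[X]) :
    reflection n (q - r) = reflection n q - reflection n r := by
  simp [reflection, reflect_sub]

theorem reflection_C_mul (n : ℕ) (a : ℂ) (q : ℂ[X]) :
    reflection n (C a * q) = C (conj a) * reflection n q := by
  simp [reflection, reflect_C_mul]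

theorem reflection_mul {k l : ℕ} {q r : ℂ[X]} (hq : q.natDegree ≤ k) (hr : r.natDegree ≤ l) :
    reflection (k + l) (q * r) = reflection k q * reflection l r := by
  unfold reflection
  rw [Polynomial.map_mul, reflect_mul _ _ (by simpa using hq) (by simpa using hr)]

theorem coeff_reflection_zero (n : ℕ) (q : ℂ[X]) :
    (reflection n q).coeff 0 = conj (q.coeff n) := by
  simp [reflection, coeff_reflect]

theorem eval_reflection {n : ℕ} {q : ℂ[X]} (hq : q.natDegree ≤ n) (ζ : Circle) :
    (reflection n q).eval (ζ : ℂ) = (ζ : ℂ) ^ n * conj (q.eval (ζ : ℂ)) := by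
  have hζ : (ζ : ℂ) ≠ 0 := Circle.coe_ne_zero ζ
  let : Invertible ((ζ : ℂ)⁻¹) := ⟨ζ, by simp, by simp⟩
  have h := eval₂_reflect_mul_pow (RingHom.id ℂ) ((ζ : ℂ)⁻¹) n (q.map (starRingEnd ℂ))
    (by simpa using hq)
  have h2 : eval ((ζ : ℂ)⁻¹) (q.map (starRingEnd ℂ)) = conj (q.eval (ζ : ℂ)) := by
    rw [← Circle.coe_inv, Circle.coe_inv_eq_conj, eval_map_apply]
  change eval (ζ : ℂ) (reflection n q) * _ = eval _ _ at h
  rw [h2] at h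
  rw [← h, inv_pow]
  field_simp

theorem norm_eval_reflection {n : ℕ} {q : ℂ[X]} (hq : q.natDegree ≤ n) (ζ : Circle) :
    ‖(reflection n q).eval (ζ : ℂ)‖ = ‖q.eval (ζ : ℂ)‖ := by
  simp [eval_reflection hq, Circle.norm_coe]

/-- The polynomial `p₁ p̃₁ - p₂ p̃₂`, equal to `ζ ^ n (|p₁|² - |p₂|²)` on the unit circle. -/
def defect (n : ℕ) (p : ℂ[X][Y]) : ℂ[X] :=
  p.coeff 0 * reflection n (p.coeff 0) - p.coeff 1 * reflection n (p.coeff 1)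

theorem evalEval_biReflection (n : ℕ) (p : ℂ[X][Y]) (z₁ z₂ : ℂ) :
    (biReflection n p).evalEval z₁ z₂ =
      (reflection n (p.coeff 1)).eval z₁ + z₂ * (reflection n (p.coeff 0)).eval z₁ := by
  simp [biReflection, evalEval, mul_comm z₂]

/-! ### Consequences of the absence of zeros and of common factors. -/

namespace IsRIFDenominator

variable {n : ℕ} {p : ℂ[X][Y]}

theorem eq_add (hp : IsRIFDenominator n p) : p = C (p.coeff 0) + X * C (p.coeff 1) := by
  conv_lhs => rw [eq_X_add_C_of_natDegree_le_one hp.natDegree_le]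
  ring

theorem evalEval_eq (hp : IsRIFDenominator n p) (z₁ z₂ : ℂ) :
    p.evalEval z₁ z₂ = (p.coeff 0).eval z₁ + z₂ * (p.coeff 1).eval z₁ := by
  conv_lhs => rw [hp.eq_add]
  simp [evalEval, mul_comm z₂]

theorem natDegree_defect_le (hp : IsRIFDenominator n p) : (defect n p).natDegree ≤ 2 * n := by
  refine (natDegree_sub_le _ _).trans (max_le ?_ ?_) <;>
  · refine natDegree_mul_le.trans ?_
    have := hp.natDegree_coeff_le
    have h0 := this 0
    have h1 := this 1
    have h2 := natDegree_reflection_le h0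
    have h3 := natDegree_reflection_le h1
    omega

theorem eval_defect (hp : IsRIFDenominator n p) (ζ : Circle) :
    (defect n p).eval (ζ : ℂ) = (ζ : ℂ) ^ n *
      ((‖(p.coeff 0).eval (ζ : ℂ)‖ ^ 2 - ‖(p.coeff 1).eval (ζ : ℂ)‖ ^ 2 : ℝ) : ℂ) := by
  simp only [defect, eval_sub, eval_mul, eval_reflection (hp.natDegree_coeff_le _)]
  push_cast
  rw [← Complex.mul_conj', ← Complex.mul_conj']
  ring

theorem coeff_zero_eval_ne_zero_of_mem_ball (hp : IsRIFDenominator n p) {z : ℂ} (hz : ‖z‖ < 1) :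
    (p.coeff 0).eval z ≠ 0 := by
  simpa [hp.evalEval_eq] using hp.evalEval_ne_zero z 0 hz (by simp)

theorem coeff_zero_ne_zero (hp : IsRIFDenominator n p) : p.coeff 0 ≠ 0 := fun h => by
  simpa [h] using hp.coeff_zero_eval_ne_zero_of_mem_ball (z := 0) (by simp)

/-- If the defect vanished, `p₂ p̃ = p̃₁ p`, so coprimality would give `p ∣ p₂`. As `p₂` has degree
`0` in `z₂`, so would `p`, forcing `p₂ = 0` and then `p₁ p̃₁ = 0`. -/
theorem defect_ne_zero (hp : IsRIFDenominator n p) : defect n p ≠ 0 := by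
  intro h
  have h1 : p.coeff 0 * reflection n (p.coeff 0) = p.coeff 1 * reflection n (p.coeff 1) :=
    sub_eq_zero.1 h
  have hr : reflection n (p.coeff 0) ≠ 0 := fun h0 => hp.coeff_zero_ne_zero <| by
    rw [← reflection_reflection n (p.coeff 0), h0]; simp [reflection]
  have hp1 : p.coeff 1 ≠ 0 := fun h0 => by
    rw [h0, zero_mul] at h1
    exact mul_ne_zero hp.coeff_zero_ne_zero hr h1
  have key : C (p.coeff 1) * biReflection n p = C (reflection n (p.coeff 0)) * p := by
    have h2 : C (p.coeff 0) * C (reflection n (p.coeff 0)) =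
        C (p.coeff 1) * C (reflection n (p.coeff 1)) := by rw [← C_mul, h1, C_mul]
    calc C (p.coeff 1) * biReflection n p
        = C (reflection n (p.coeff 0)) * (C (p.coeff 0) + X * C (p.coeff 1)) := by
          unfold biReflection
          linear_combination -h2
      _ = C (reflection n (p.coeff 0)) * p := by rw [← hp.eq_add]
  have hdvd : p ∣ C (p.coeff 1) :=
    hp.isRelPrime.dvd_of_dvd_mul_right ⟨C (reflection n (p.coeff 0)), by rw [key]; ring⟩
  have hd := natDegree_le_of_dvd hdvd (by simpa using hp1)
  rw [natDegree_C] at hd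
  exact hp1 (coeff_eq_zero_of_natDegree_lt (by omega))

/-- Reflection preserves zeros on the circle, so a common zero `ζ` would make `z₁ - ζ` a common
factor of `p` and `p̃`. -/
theorem eval_ne_zero_or (hp : IsRIFDenominator n p) (ζ : Circle) :
    (p.coeff 0).eval (ζ : ℂ) ≠ 0 ∨ (p.coeff 1).eval (ζ : ℂ) ≠ 0 := by
  by_contra! h
  have hC : ∀ q : ℂ[X], q.eval (ζ : ℂ) = 0 → (C (X - C (ζ : ℂ)) : ℂ[X][Y]) ∣ C q := by
    intro q h0
    obtain ⟨r, hr⟩ := dvd_iff_isRoot.2 h0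
    exact ⟨C r, by rw [hr, C_mul]⟩
  have hd : ∀ q : ℂ[X], q.natDegree ≤ n → q.eval (ζ : ℂ) = 0 →
      (C (X - C (ζ : ℂ)) : ℂ[X][Y]) ∣ C q ∧ (C (X - C (ζ : ℂ)) : ℂ[X][Y]) ∣ C (reflection n q) := by
    intro q hq h0
    refine ⟨hC q h0, hC _ ?_⟩
    rw [eval_reflection hq, h0, map_zero, mul_zero]
  obtain ⟨h00, h01⟩ := hd _ (hp.natDegree_coeff_le 0) h.1
  obtain ⟨h10, h11⟩ := hd _ (hp.natDegree_coeff_le 1) h.2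
  have hu : IsUnit (C (X - C (ζ : ℂ)) : ℂ[X][Y]) := by
    refine hp.isRelPrime ?_ (dvd_add h11 (h01.mul_left _))
    rw [hp.eq_add]
    exact dvd_add h00 (h10.mul_left _)
  exact not_isUnit_X_sub_C (ζ : ℂ) (isUnit_C.1 hu)

/-- Otherwise the root `z₂ = -p₁(z) / p₂(z)` of `p(z, ·)` would lie in the open disk. -/
theorem norm_coeff_one_le_of_mem_ball (hp : IsRIFDenominator n p) {z : ℂ} (hz : ‖z‖ < 1) :
    ‖(p.coeff 1).eval z‖ ≤ ‖(p.coeff 0).eval z‖ := by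
  by_contra! h
  have h1 : (p.coeff 1).eval z ≠ 0 := fun h0 => by
    rw [h0, norm_zero] at h; exact (norm_nonneg _).not_gt h
  refine hp.evalEval_ne_zero z (-((p.coeff 0).eval z / (p.coeff 1).eval z)) hz ?_ ?_
  · rw [norm_neg, norm_div]
    exact (div_lt_one (norm_pos_iff.2 h1)).2 h
  · rw [hp.evalEval_eq]
    field_simp
    ring

theorem norm_coeff_one_le (hp : IsRIFDenominator n p) {z : ℂ} (hz : ‖z‖ ≤ 1) :
    ‖(p.coeff 1).eval z‖ ≤ ‖(p.coeff 0).eval z‖ := by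
  have hcl : z ∈ closure (Metric.ball (0 : ℂ) 1) := by
    rw [closure_ball _ one_ne_zero]; simpa using hz
  refine le_on_closure (f := fun z => ‖(p.coeff 1).eval z‖) (g := fun z => ‖(p.coeff 0).eval z‖)
    (fun w hw => hp.norm_coeff_one_le_of_mem_ball (by simpa using hw)) ?_ ?_ hcl
  · exact (p.coeff 1).continuous.norm.continuousOn
  · exact (p.coeff 0).continuous.norm.continuousOn

theorem coeff_zero_eval_circle_ne_zero (hp : IsRIFDenominator n p) (ζ : Circle) :
    (p.coeff 0).eval (ζ : ℂ) ≠ 0 := by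
  intro h0
  have := hp.norm_coeff_one_le (z := (ζ : ℂ)) (Circle.norm_coe ζ).le
  rw [h0, norm_zero, norm_le_zero_iff] at this
  exact (hp.eval_ne_zero_or ζ).elim (· h0) (· this)

theorem coeff_zero_eval_ne_zero (hp : IsRIFDenominator n p) {z : ℂ} (hz : ‖z‖ ≤ 1) :
    (p.coeff 0).eval z ≠ 0 := by
  rcases hz.lt_or_eq with h | h
  · exact hp.coeff_zero_eval_ne_zero_of_mem_ball h
  · exact hp.coeff_zero_eval_circle_ne_zero ⟨z, by simpa [Submonoid.unitSphere] using h⟩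

/-- Maximum principle for `p̃₂ / p₁`, whose modulus on the circle is that of `p₂ / p₁`. -/
theorem norm_reflection_coeff_one_le (hp : IsRIFDenominator n p) {z : ℂ} (hz : ‖z‖ ≤ 1) :
    ‖(reflection n (p.coeff 1)).eval z‖ ≤ ‖(p.coeff 0).eval z‖ := by
  have hcl : z ∈ closure (Metric.ball (0 : ℂ) 1) := by
    rw [closure_ball _ one_ne_zero]; simpa using hz
  have hd : DiffContOnCl ℂ (fun w => (reflection n (p.coeff 1)).eval w / (p.coeff 0).eval w)
      (Metric.ball 0 1) := by
    refine DifferentiableOn.diffContOnCl ?_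
    rw [closure_ball _ one_ne_zero]
    exact (Polynomial.differentiable _).differentiableOn.div
      (Polynomial.differentiable _).differentiableOn
      fun w hw => hp.coeff_zero_eval_ne_zero (by simpa using hw)
  have h := Complex.norm_le_of_forall_mem_frontier_norm_le Metric.isBounded_ball hd (C := 1) ?_ hcl
  · rw [norm_div] at h
    exact (div_le_one (norm_pos_iff.2 (hp.coeff_zero_eval_ne_zero hz))).1 h
  · intro w hw
    rw [frontier_ball _ one_ne_zero] at hw
    have hw1 : ‖w‖ = 1 := by simpa using hw
    rw [norm_div]
    refine (div_le_one (norm_pos_iff.2 (hp.coeff_zero_eval_ne_zero hw1.le))).2 ?_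
    have := norm_eval_reflection (hp.natDegree_coeff_le 1)
      (⟨w, by simpa [Submonoid.unitSphere] using hw1⟩ : Circle)
    exact this.le.trans (hp.norm_coeff_one_le hw1.le)

end IsRIFDenominator

/-! ### Counting the zeros of the defect on the circle. -/

/-- If the real-valued function `t ↦ (τ e^{it})⁻ⁿ q (τ e^{it})` is nonnegative, then every zero of
the polynomial `q` on the unit circle is a double zero. -/
theorem derivative_eval_eq_zero_of_nonneg {n : ℕ} {q : ℂ[X]} {u : Circle → ℝ}
    (hu : ∀ ζ, 0 ≤ u ζ) (hq : ∀ ζ : Circle, q.eval (ζ : ℂ) = (ζ : ℂ) ^ n * (u ζ : ℂ))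
    {τ : Circle} (hτ : q.eval (τ : ℂ) = 0) : (derivative q).eval (τ : ℂ) = 0 := by
  let e : ℝ → ℂ := fun t => (τ * Circle.exp t : Circle)
  have he0 : e 0 = τ := by simp [e]
  have hne : ∀ t, e t ≠ 0 := fun t => Circle.coe_ne_zero _
  have he : HasDerivAt e (τ * Complex.I) 0 := by
    have h1 : HasDerivAt (fun t : ℝ => (τ : ℂ) * Complex.exp (t * Complex.I))
        ((τ : ℂ) * (Complex.exp ((0 : ℝ) * Complex.I) * (1 * Complex.I))) 0 := by
      refine HasDerivAt.const_mul _ (HasDerivAt.cexp ?_)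
      exact (Complex.ofRealCLM.hasDerivAt (x := (0 : ℝ))).mul_const Complex.I
    convert h1 using 1
    · ext t; simp [e, Circle.coe_exp]
    · simp
  have hv : HasDerivAt (fun t => (u (τ * Circle.exp t) : ℂ))
      (((derivative q).eval (τ : ℂ) * (τ * Complex.I)) / (τ : ℂ) ^ n) 0 := by
    have h1 : HasDerivAt (fun t => q.eval (e t))
        ((derivative q).eval (τ : ℂ) * (τ * Complex.I)) 0 := by
      have := q.hasDerivAt (e 0)
      have := HasDerivAt.comp (0 : ℝ) this he
      rwa [he0] at this
    have h2 := h1.div (he.pow n) (pow_ne_zero n (hne 0))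
    refine (h2.congr_deriv ?_).congr_of_eventuallyEq (Eventually.of_forall fun t => ?_)
    · simp only [he0, hτ, zero_mul, sub_zero, Pi.pow_apply]
      have := Circle.coe_ne_zero τ
      field_simp
    · simp only [e, hq, Pi.div_apply, Pi.pow_apply]
      rw [mul_div_cancel_left₀ _ (pow_ne_zero n (Circle.coe_ne_zero _))]
  have hu' : HasDerivAt (fun t => u (τ * Circle.exp t))
      ((((derivative q).eval (τ : ℂ) * (τ * Complex.I)) / (τ : ℂ) ^ n)).re 0 := by
    exact HasFDerivAt.comp_hasDerivAt (f := fun t : ℝ => ((u (τ * Circle.exp t) : ℝ) : ℂ)) (0 : ℝ)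
      Complex.reCLM.hasFDerivAt hv
  -- `u` vanishes at `τ` and is nonnegative everywhere, so `t = 0` is a minimum and the derivative
  -- there is zero.
  have hmin : IsLocalMin (fun t => u (τ * Circle.exp t)) 0 := by
    refine Eventually.of_forall fun t => ?_
    have h0 : u τ = 0 := by
      have := hq τ
      rw [hτ] at this
      simpa using this.symm
    simpa [h0] using hu _
  have h0 := hmin.hasDerivAt_eq_zero hu'
  rw [h0] at hu'
  have := hv.unique hu'.ofReal_comp
  have hτ0 := Circle.coe_ne_zero τ
  simpa [hτ0] using this

namespace IsRIFDenominator

variable {n : ℕ} {p : ℂ[X][Y]}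

theorem defect_eval_eq_zero_iff (hp : IsRIFDenominator n p) (ζ : Circle) :
    (defect n p).eval (ζ : ℂ) = 0 ↔
      ‖(p.coeff 0).eval (ζ : ℂ)‖ = ‖(p.coeff 1).eval (ζ : ℂ)‖ := by
  rw [hp.eval_defect, mul_eq_zero, or_iff_right (pow_ne_zero _ (Circle.coe_ne_zero _)),
    Complex.ofReal_eq_zero, sub_eq_zero, sq_eq_sq₀ (norm_nonneg _) (norm_nonneg _)]

theorem derivative_defect_eval (hp : IsRIFDenominator n p) {τ : Circle}
    (hτ : (defect n p).eval (τ : ℂ) = 0) : (derivative (defect n p)).eval (τ : ℂ) = 0 := by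
  refine derivative_eval_eq_zero_of_nonneg (fun ζ => ?_) hp.eval_defect hτ
  have := hp.norm_coeff_one_le (Circle.norm_coe ζ).le
  exact sub_nonneg.2 (pow_le_pow_left₀ (norm_nonneg _) this 2)

/-- The zeros of the defect polynomial on the unit circle are finite in number, at most `n`. -/
theorem exists_finset_defect_roots (hp : IsRIFDenominator n p) :
    ∃ S : Finset Circle, S.card ≤ n ∧ ∀ ζ, ζ ∈ S ↔ (defect n p).eval (ζ : ℂ) = 0 := by
  classical
  have hinj : Function.Injective (fun ζ : Circle => (ζ : ℂ)) := fun _ _ h =>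
    Circle.ext h
  let S := (defect n p).roots.toFinset.preimage (fun ζ : Circle => (ζ : ℂ)) hinj.injOn
  have hS : ∀ ζ, ζ ∈ S ↔ (defect n p).eval (ζ : ℂ) = 0 := fun ζ => by
    simp [S, hp.defect_ne_zero]
  refine ⟨S, ?_, hS⟩
  -- Every zero on the circle has multiplicity at least two, and the degree is at most `2n`.
  have h1 : S.card * 2 ≤ ∑ z ∈ S.image (fun ζ : Circle => (ζ : ℂ)), (defect n p).roots.count z := by
    rw [← Finset.card_image_of_injective S hinj]
    refine Finset.card_nsmul_le_sum _ _ 2 fun z hz => ?_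
    obtain ⟨ζ, hζ, rfl⟩ := Finset.mem_image.1 hz
    rw [count_roots]
    exact (one_lt_rootMultiplicity_iff_isRoot hp.defect_ne_zero).2
      ⟨(hS ζ).1 hζ, hp.derivative_defect_eval ((hS ζ).1 hζ)⟩
  have h2 : ∑ z ∈ S.image (fun ζ : Circle => (ζ : ℂ)), (defect n p).roots.count z ≤
      ∑ z ∈ (defect n p).roots.toFinset, (defect n p).roots.count z := by
    refine Finset.sum_le_sum_of_subset fun z hz => ?_
    obtain ⟨ζ, hζ, rfl⟩ := Finset.mem_image.1 hz
    exact Finset.mem_preimage.1 hζ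
  rw [Multiset.toFinset_sum_count_eq] at h2
  have h3 := (defect n p).card_roots'
  have h4 := hp.natDegree_defect_le
  omega

end IsRIFDenominator

/-! ### Schwarz-Pick estimates and angular derivatives. -/

/-- A consequence of the Schwarz-Pick lemma: a holomorphic self-map of the disk that is not a
unimodular constant satisfies `‖f z‖ ≤ 1 - c (1 - ‖z‖)` for some `c > 0`. -/
theorem exists_norm_le_one_sub_mul {f : ℂ → ℂ} (hf : DifferentiableOn ℂ f (Metric.ball 0 1))
    (hb : ∀ z, ‖z‖ < 1 → ‖f z‖ ≤ 1) (h0 : ‖f 0‖ < 1) :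
    ∃ c > 0, ∀ z, ‖z‖ < 1 → ‖f z‖ ≤ 1 - c * (1 - ‖z‖) := by
  set a := f 0 with ha
  have hden : ∀ z, ‖z‖ < 1 → 1 - ‖a‖ ≤ ‖1 - conj a * f z‖ := fun z hz => by
    have h1 : ‖conj a * f z‖ ≤ ‖a‖ := by
      rw [norm_mul, Complex.norm_conj]
      exact mul_le_of_le_one_right (norm_nonneg _) (hb z hz)
    have h2 := norm_sub_norm_le (1 : ℂ) (conj a * f z)
    rw [norm_one] at h2
    linarith
  have hne : ∀ z, ‖z‖ < 1 → 1 - conj a * f z ≠ 0 := fun z hz =>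
    norm_pos_iff.1 (lt_of_lt_of_le (by linarith) (hden z hz))
  have hid : ∀ z, ‖z‖ < 1 → ‖1 - conj a * f z‖ ^ 2 - ‖f z - a‖ ^ 2 =
      (1 - ‖a‖ ^ 2) * (1 - ‖f z‖ ^ 2) := fun z _ => by
    simp only [Complex.sq_norm, Complex.normSq_apply, Complex.sub_re, Complex.sub_im,
      Complex.mul_re, Complex.mul_im, Complex.conj_re, Complex.conj_im, Complex.one_re,
      Complex.one_im]
    ring
  have ha2 : 0 < 1 - ‖a‖ ^ 2 := by nlinarith [norm_nonneg a]
  -- Schwarz lemma for `f` followed by the disk automorphism that sends `a` to `0`.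
  have hg : ∀ z, ‖z‖ < 1 → ‖(f z - a) / (1 - conj a * f z)‖ ≤ ‖z‖ := fun z hz => by
    refine Complex.norm_le_norm_of_mapsTo_ball (R := 1)
      (f := fun z => (f z - a) / (1 - conj a * f z)) ?_ ?_ ?_ hz
    · exact (hf.sub_const a).div ((hf.const_mul _).const_sub 1)
        fun w hw => hne w (by simpa using hw)
    · intro w hw
      have hw : ‖w‖ < 1 := by simpa using hw
      rw [mem_closedBall_zero_iff, norm_div]
      refine (div_le_one (norm_pos_iff.2 (hne w hw))).2 ?_
      refine (sq_le_sq₀ (norm_nonneg _) (norm_nonneg _)).1 (sub_nonneg.1 ?_)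
      rw [hid w hw]
      have := hb w hw
      exact mul_nonneg ha2.le (by nlinarith [norm_nonneg (f w)])
    · simp [← ha]
  -- The estimate obtained is `(1 - ‖a‖)² (1 - ‖z‖) ≤ 1 - ‖f z‖²`; the `2` comes from `1 - x² ≤ 2 (1
  -- - x)`.
  refine ⟨(1 - ‖a‖) ^ 2 / 2 , by have := sub_pos.2 h0; positivity, fun z hz => ?_⟩
  have h1 := hg z hz
  rw [norm_div, div_le_iff₀ (norm_pos_iff.2 (hne z hz))] at h1
  have h2 : ‖f z - a‖ ^ 2 ≤ ‖z‖ ^ 2 * ‖1 - conj a * f z‖ ^ 2 := by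
    rw [← mul_pow]; exact pow_le_pow_left₀ (norm_nonneg _) h1 2
  have h3 := hid z hz
  have h4 : (1 - ‖a‖) ^ 2 ≤ ‖1 - conj a * f z‖ ^ 2 :=
    pow_le_pow_left₀ (by linarith) (hden z hz) 2
  have h5 := hb z hz
  have h6 : (1 - ‖z‖) * (1 - ‖a‖) ^ 2 ≤ (1 - ‖z‖ ^ 2) * ‖1 - conj a * f z‖ ^ 2 :=
    mul_le_mul (by nlinarith [norm_nonneg z]) h4 (by positivity) (by nlinarith [norm_nonneg z])
  have h7 : (1 - ‖z‖) * (1 - ‖a‖) ^ 2 ≤ 1 - ‖f z‖ ^ 2 := by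
    refine h6.trans ?_
    have h8 : (1 - ‖a‖ ^ 2) * (1 - ‖f z‖ ^ 2) ≤ 1 * (1 - ‖f z‖ ^ 2) :=
      mul_le_mul_of_nonneg_right (by nlinarith [norm_nonneg a]) (by nlinarith [norm_nonneg (f z)])
    nlinarith
  nlinarith [norm_nonneg (f z)]

/-- If a self-map of the disk with `‖f z‖ ≤ 1 - c (1 - ‖z‖)` has a derivative at a boundary point
where its value is unimodular, then its angular derivative there is a positive number. -/
theorem exists_pos_mul_deriv_eq {f : ℂ → ℂ} {f' : ℂ} {τ β : Circle} {c : ℝ} (hc : 0 < c)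
    (hf : HasDerivAt f f' τ) (hτ : f τ = β) (hb : ∀ z, ‖z‖ < 1 → ‖f z‖ ≤ 1 - c * (1 - ‖z‖)) :
    ∃ s : ℝ, 0 < s ∧ f' = s * β * conj (τ : ℂ) := by
  have hττ : conj (τ : ℂ) * τ = 1 := by rw [mul_comm, Complex.mul_conj', Circle.norm_coe]; simp
  have hββ : conj (β : ℂ) * β = 1 := by rw [mul_comm, Complex.mul_conj', Circle.norm_coe]; simp
  set a : ℂ := conj (β : ℂ) * f' * τ with ha
  -- directional derivative along `τ (1 - ε w)`
  have key : ∀ w : ℂ, 0 < w.re → c * w.re ≤ (a * w).re := by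
    intro w hw
    let h : ℝ → ℝ := fun ε => (conj (β : ℂ) * f (τ * (1 - ε * w))).re
    -- The squared norm is polynomial in `ε`. Passing to it costs a factor `1/2`, which the slope
    -- `-2 Re w` of `k` at `0` gives back.
    let k : ℝ → ℝ := fun ε => ‖(1 : ℂ) - ε * w‖ ^ 2
    have hh : HasDerivAt h (-(a * w).re) 0 := by
      have h1 : HasDerivAt (fun ε : ℝ => (τ : ℂ) * (1 - ε * w)) (τ * -(1 * w)) 0 :=
        (((Complex.ofRealCLM.hasDerivAt (x := (0 : ℝ))).mul_const w).const_sub 1).const_mul _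
      have h2 : HasDerivAt f f' ((τ : ℂ) * (1 - ((0 : ℝ) : ℂ) * w)) := by simpa using hf
      have h3 := (HasDerivAt.comp (0 : ℝ) h2 h1).const_mul (conj (β : ℂ))
      have h4 := (Complex.reCLM.hasFDerivAt
        (x := (conj (β : ℂ) * f (τ * (1 - ((0 : ℝ) : ℂ) * w))))).comp_hasDerivAt (0 : ℝ) h3
      refine HasDerivAt.congr_deriv (f := h) h4 ?_
      rw [Complex.reCLM_apply, ← Complex.neg_re, ha]
      congr 1
      ring
    have hk : HasDerivAt k (-(2 * w.re)) 0 := by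
      have h1 : k = fun ε => 1 - 2 * w.re * ε + ‖w‖ ^ 2 * ε ^ 2 := by
        ext ε
        simp only [k, Complex.sq_norm, Complex.normSq_apply]
        simp
        ring
      rw [h1]
      have := (((hasDerivAt_id (0 : ℝ)).const_mul (2 * w.re)).const_sub 1).add
        (((hasDerivAt_id (0 : ℝ)).pow 2).const_mul (‖w‖ ^ 2))
      exact this.congr_deriv (by simp)
    have hsmall : ∀ᶠ ε : ℝ in 𝓝[>] 0, k ε < 1 := by
      have := hk.hasDerivWithinAt (s := Set.Ioi 0)
      have hs := (hasDerivWithinAt_iff_tendsto_slope' (by simp)).1 this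
      have hneg : -(2 * w.re) < 0 := by linarith
      filter_upwards [hs.eventually_lt_const hneg, self_mem_nhdsWithin] with ε h1 h2
      have h2 : 0 < ε := h2
      rw [slope_def_field, div_lt_iff₀ (by simpa using h2)] at h1
      have : k 0 = 1 := by simp [k]
      linarith
    -- `h ≤ 1 - (c/2)(1 - k)`
    have hle : ∀ᶠ ε : ℝ in 𝓝[>] 0, h ε ≤ 1 - c / 2 * (1 - k ε) := by
      filter_upwards [hsmall] with ε hε
      have hn : ‖(τ : ℂ) * (1 - ε * w)‖ ^ 2 = k ε := by rw [norm_mul, Circle.norm_coe, one_mul]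
      have hlt : ‖(τ : ℂ) * (1 - ε * w)‖ < 1 := by
        rw [← hn] at hε
        exact (sq_lt_one_iff₀ (norm_nonneg _)).1 hε
      have h1 : h ε ≤ ‖f (τ * (1 - ε * w))‖ := by
        refine (Complex.re_le_norm _).trans ?_
        rw [norm_mul, Complex.norm_conj, Circle.norm_coe, one_mul]
      have h2 := hb _ hlt
      rw [← hn]
      have h3 : (1 - ‖(τ : ℂ) * (1 - ε * w)‖ ^ 2) / 2 ≤ 1 - ‖(τ : ℂ) * (1 - ε * w)‖ := by
        nlinarith [sq_nonneg (1 - ‖(τ : ℂ) * (1 - ε * w)‖)]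
      have h4 := mul_le_mul_of_nonneg_left h3 hc.le
      linarith
    have hd : HasDerivAt (fun ε => h ε + c / 2 * (1 - k ε))
        (-(a * w).re + c / 2 * (-(-(2 * w.re)))) 0 := hh.add ((hk.const_sub 1).const_mul _)
    have h00 : h 0 + c / 2 * (1 - k 0) = 1 := by
      have h1 : h 0 = 1 := by
        simp only [h]
        rw [show (τ : ℂ) * (1 - ((0 : ℝ) : ℂ) * w) = τ by simp, hτ, hββ, Complex.one_re]
      simp [h1, k]
    have hs := (hasDerivWithinAt_iff_tendsto_slope' (by simp)).1
      (hd.hasDerivWithinAt (s := Set.Ioi 0))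
    have : -(a * w).re + c / 2 * (-(-(2 * w.re))) ≤ 0 := by
      refine le_of_tendsto hs ?_
      filter_upwards [hle, self_mem_nhdsWithin] with ε h1 h2
      have h2 : 0 < ε := h2
      rw [slope_def_field, h00]
      exact div_nonpos_of_nonpos_of_nonneg (by linarith) (by linarith)
    linarith
  have hre : c ≤ a.re := by simpa using key 1 (by simp)
  have him : a.im = 0 := by
    by_contra h
    -- This direction `w` is chosen so that `Re (a w) = -1`, against `Re (a w) ≥ c > 0`.
    have := key (1 + (((a.re + 1) / a.im : ℝ) : ℂ) * Complex.I) (by simp)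
    simp at this
    rw [mul_div_cancel₀ _ h] at this
    linarith
  refine ⟨a.re, hc.trans_le hre, ?_⟩
  have : ((a.re : ℝ) : ℂ) = a := Complex.ext rfl (by simp [him])
  rw [this, ha]
  linear_combination (-f' * conj (β : ℂ) * β) * hττ - f' * hββ

theorem Circle.coe_mul_conj (ζ : Circle) : (ζ : ℂ) * conj (ζ : ℂ) = 1 := by
  rw [Complex.mul_conj', Circle.norm_coe]; simp

theorem reflection_eq_of_eq_C_mul {n : ℕ} {q r : ℂ[X]} {a : ℂ} (h : q = C a * r) :
    reflection n q = C (conj a) * reflection n r := by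
  rw [h, reflection_C_mul]

namespace IsRIFDenominator

variable {n : ℕ} {p : ℂ[X][Y]}

theorem differentiableOn_div (hp : IsRIFDenominator n p) (q : ℂ[X]) :
    DifferentiableOn ℂ (fun z => q.eval z / (p.coeff 0).eval z) (Metric.ball 0 1) :=
  q.differentiable.differentiableOn.div (Polynomial.differentiable _).differentiableOn
    fun w hw => hp.coeff_zero_eval_ne_zero_of_mem_ball (by simpa using hw)

/-- A quotient of modulus one at `0` would be a unimodular constant by the maximum principle, which
`hne` excludes. Otherwise `exists_norm_le_one_sub_mul` applies. -/
theorem exists_norm_div_le (hp : IsRIFDenominator n p) {q : ℂ[X]}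
    (hq : ∀ z : ℂ, ‖z‖ < 1 → ‖q.eval z‖ ≤ ‖(p.coeff 0).eval z‖)
    (hne : ∀ u : Circle, q ≠ C (u : ℂ) * p.coeff 0) :
    ∃ c > 0, ∀ z : ℂ, ‖z‖ < 1 → ‖q.eval z / (p.coeff 0).eval z‖ ≤ 1 - c * (1 - ‖z‖) := by
  have hb : ∀ z : ℂ, ‖z‖ < 1 → ‖q.eval z / (p.coeff 0).eval z‖ ≤ 1 := fun z hz => by
    rw [norm_div]
    exact (div_le_one (norm_pos_iff.2 (hp.coeff_zero_eval_ne_zero_of_mem_ball hz))).2 (hq z hz)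
  refine exists_norm_le_one_sub_mul (hp.differentiableOn_div q) hb ?_
  refine (hb 0 (by simp)).lt_of_ne fun h => ?_
  have hconst := Complex.eq_const_of_exists_max (hp.differentiableOn_div q) (v := 0) (by simp)
    fun z hz => by
      simp only [Set.mem_ofPred_eq, Function.comp_apply, h]
      exact hb z (by simpa using hz)
  refine hne ⟨q.eval 0 / (p.coeff 0).eval 0, by simpa [Submonoid.unitSphere] using h⟩ ?_
  refine Polynomial.eq_of_infinite_eval_eq _ _
    ((infinite_of_mem_nhds (0 : ℂ) (Metric.ball_mem_nhds (0 : ℂ) one_pos)).mono fun z hz => ?_)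
  have h1 := hconst hz
  have h2 := hp.coeff_zero_eval_ne_zero_of_mem_ball (z := z) (by simpa using hz)
  simp only [Function.const_apply] at h1
  rw [div_eq_iff h2] at h1
  simp [h1]

/-- Proportionality with a unimodular factor would also make the reflections proportional, with the
conjugate factor, and the defect would vanish. -/
theorem coeff_one_ne_C_mul (hp : IsRIFDenominator n p) (u : Circle) :
    p.coeff 1 ≠ C (u : ℂ) * p.coeff 0 := fun h => hp.defect_ne_zero <| by
  have h2 := reflection_eq_of_eq_C_mul (n := n) h
  have h3 : C (u : ℂ) * C (conj (u : ℂ)) = 1 := by rw [← C_mul, Circle.coe_mul_conj, C_1]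
  rw [defect, h2, h]
  linear_combination (-(p.coeff 0) * reflection n (p.coeff 0)) * h3

theorem reflection_coeff_one_ne_C_mul (hp : IsRIFDenominator n p) (u : Circle) :
    reflection n (p.coeff 1) ≠ C (u : ℂ) * p.coeff 0 := fun h => hp.defect_ne_zero <| by
  have h2 := reflection_eq_of_eq_C_mul (n := n) h
  rw [reflection_reflection] at h2
  have h3 : C (u : ℂ) * C (conj (u : ℂ)) = 1 := by rw [← C_mul, Circle.coe_mul_conj, C_1]
  rw [defect, h, h2]
  linear_combination (-(p.coeff 0) * reflection n (p.coeff 0)) * h3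

/-- This bounds `|p|` from below by a multiple of `1 - |z₁|`, uniformly in `z₂`, which is what
non-tangential limits need. -/
theorem exists_norm_coeff_one_le (hp : IsRIFDenominator n p) :
    ∃ c > 0, ∀ z : ℂ, ‖z‖ < 1 →
      c * (1 - ‖z‖) * ‖(p.coeff 0).eval z‖ ≤ ‖(p.coeff 0).eval z‖ - ‖(p.coeff 1).eval z‖ := by
  obtain ⟨c, hc, h⟩ := hp.exists_norm_div_le (fun z hz => hp.norm_coeff_one_le hz.le)
    hp.coeff_one_ne_C_mul
  refine ⟨c, hc, fun z hz => ?_⟩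
  have h1 := h z hz
  rw [norm_div, div_le_iff₀ (norm_pos_iff.2 (hp.coeff_zero_eval_ne_zero_of_mem_ball hz))] at h1
  linarith

end IsRIFDenominator

/-! ### Value and derivative of the rational inner function at a singularity. -/

/-- The local behaviour of `p̃ / p` at a boundary zero `(τ, lam)` of `p`: the value `β` and the
modulus `s` of the `z₁`-derivative of `p̃ / p` on `{τ} × 𝔻`. -/
structure IsSingularity (n : ℕ) (p : ℂ[X][Y]) (τ lam β : Circle) (s : ℝ) : Prop where
  pos : 0 < s
  coeff_zero : (p.coeff 0).eval (τ : ℂ) = -lam * (p.coeff 1).eval (τ : ℂ)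
  coeff_one_ne_zero : (p.coeff 1).eval (τ : ℂ) ≠ 0
  reflection_coeff_zero : (reflection n (p.coeff 0)).eval (τ : ℂ) = β * (p.coeff 1).eval (τ : ℂ)
  reflection_coeff_one : (reflection n (p.coeff 1)).eval (τ : ℂ) = β * (p.coeff 0).eval (τ : ℂ)
  derivative_coeff_zero : (derivative (reflection n (p.coeff 0))).eval (τ : ℂ) -
    β * (derivative (p.coeff 1)).eval (τ : ℂ) = s * β * conj (τ : ℂ) * (p.coeff 1).eval (τ : ℂ)
  derivative_coeff_one : (derivative (reflection n (p.coeff 1))).eval (τ : ℂ) -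
    β * (derivative (p.coeff 0)).eval (τ : ℂ) = s * β * conj (τ : ℂ) * (p.coeff 0).eval (τ : ℂ)

/-- At a zero of the defect `|p₁| = |p₂| ≠ 0`, so the quotients defining `lam` and `β` are
unimodular. The number `s` is the modulus of the angular derivative of `p̃₂ / p₁` at `τ`. -/
theorem IsRIFDenominator.exists_isSingularity {n : ℕ} {p : ℂ[X][Y]} (hp : IsRIFDenominator n p)
    {τ : Circle} (hτ : (defect n p).eval (τ : ℂ) = 0) :
    ∃ lam β s, IsSingularity n p τ lam β s := by
  have hnorm := (hp.defect_eval_eq_zero_iff τ).1 hτ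
  have h0 := hp.coeff_zero_eval_circle_ne_zero τ
  have h1 : (p.coeff 1).eval (τ : ℂ) ≠ 0 := by rwa [← norm_ne_zero_iff, ← hnorm, norm_ne_zero_iff]
  have hr0 := eval_reflection (hp.natDegree_coeff_le 0) τ
  have hr1 := eval_reflection (hp.natDegree_coeff_le 1) τ
  let lam : Circle := ⟨-(p.coeff 0).eval (τ : ℂ) / (p.coeff 1).eval (τ : ℂ), by
    simp [Submonoid.unitSphere, hnorm, h1]⟩
  let β : Circle := ⟨(reflection n (p.coeff 0)).eval (τ : ℂ) / (p.coeff 1).eval (τ : ℂ), by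
    simp [Submonoid.unitSphere, norm_eval_reflection (hp.natDegree_coeff_le 0), hnorm, h1]⟩
  have hlam : (lam : ℂ) = -(p.coeff 0).eval (τ : ℂ) / (p.coeff 1).eval (τ : ℂ) := rfl
  have hβ : (β : ℂ) = (reflection n (p.coeff 0)).eval (τ : ℂ) / (p.coeff 1).eval (τ : ℂ) := rfl
  have e0 : (p.coeff 0).eval (τ : ℂ) = -lam * (p.coeff 1).eval (τ : ℂ) := by
    rw [hlam]; field_simp
  have e1 : (reflection n (p.coeff 0)).eval (τ : ℂ) = β * (p.coeff 1).eval (τ : ℂ) := by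
    rw [hβ]; field_simp
  have hd : (p.coeff 0).eval (τ : ℂ) * (reflection n (p.coeff 0)).eval (τ : ℂ) -
      (p.coeff 1).eval (τ : ℂ) * (reflection n (p.coeff 1)).eval (τ : ℂ) = 0 := by
    simpa [defect] using hτ
  have e2 : (reflection n (p.coeff 1)).eval (τ : ℂ) = β * (p.coeff 0).eval (τ : ℂ) := by
    refine mul_left_cancel₀ h1 ?_
    linear_combination -hd + (p.coeff 0).eval (τ : ℂ) * e1
  have hdd := hp.derivative_defect_eval hτ
  simp only [defect, derivative_sub, derivative_mul, eval_sub, eval_add, eval_mul, e1, e2] at hdd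
  obtain ⟨c, hc, hbd⟩ := hp.exists_norm_div_le
    (fun z hz => hp.norm_reflection_coeff_one_le hz.le) hp.reflection_coeff_one_ne_C_mul
  obtain ⟨s, hs, hs'⟩ := exists_pos_mul_deriv_eq (β := β) hc
    (((reflection n (p.coeff 1)).hasDerivAt (τ : ℂ)).div ((p.coeff 0).hasDerivAt (τ : ℂ)) h0)
    (by rw [Pi.div_apply, e2]; field_simp) hbd
  rw [e2, div_eq_iff (pow_ne_zero 2 h0)] at hs'
  have e3 : (derivative (reflection n (p.coeff 1))).eval (τ : ℂ) -
      β * (derivative (p.coeff 0)).eval (τ : ℂ) =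
        s * β * conj (τ : ℂ) * (p.coeff 0).eval (τ : ℂ) := by
    refine mul_right_cancel₀ h0 ?_
    linear_combination hs'
  refine ⟨lam, β, s, hs, e0, h1, e1, e2, ?_, e3⟩
  -- The zero of the defect is double: its vanishing derivative carries the relation for `p̃₂ - β
  -- p₁` over to `p̃₁ - β p₂`.
  refine mul_left_cancel₀ h0 ?_
  linear_combination hdd + (p.coeff 1).eval (τ : ℂ) * e3

theorem mem_boundaryZeros_iff {n : ℕ} {p : ℂ[X][Y]} (hp : IsRIFDenominator n p)
    {τ lam β : Circle} {s : ℝ} (h : IsSingularity n p τ lam β s) (lam' : Circle) :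
    (τ, lam') ∈ boundaryZeros p ↔ lam' = lam := by
  simp only [boundaryZeros, Set.mem_ofPred_eq, hp.evalEval_eq, h.coeff_zero]
  rw [← add_mul, mul_eq_zero, or_iff_left h.coeff_one_ne_zero, neg_add_eq_zero, eq_comm]
  exact Circle.coe_inj

theorem defect_eval_eq_zero_of_mem_boundaryZeros {n : ℕ} {p : ℂ[X][Y]} (hp : IsRIFDenominator n p)
    {ζ : Circle × Circle} (h : ζ ∈ boundaryZeros p) : (defect n p).eval (ζ.1 : ℂ) = 0 := by
  rw [hp.defect_eval_eq_zero_iff]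
  simp only [boundaryZeros, Set.mem_ofPred_eq, hp.evalEval_eq] at h
  rw [eq_neg_of_add_eq_zero_left h, norm_neg, norm_mul, Circle.norm_coe, one_mul]

theorem evalEval_ne_zero_of_ne {n : ℕ} {p : ℂ[X][Y]} {τ lam β : Circle} {s : ℝ}
    (h : IsSingularity n p τ lam β s) {z₂ : ℂ} (hz : z₂ ≠ lam) :
    (p.coeff 0).eval (τ : ℂ) + z₂ * (p.coeff 1).eval (τ : ℂ) ≠ 0 := by
  rw [h.coeff_zero, ← add_mul, neg_add_eq_sub]
  exact mul_ne_zero (sub_ne_zero.2 hz) h.coeff_one_ne_zero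

/-- For every `z₂`, `p̃ - β p` vanishes at `z₁ = τ` and its `z₁`-derivative there is `s β τ̄ p(τ,
z₂)`. Dividing by `p(τ, z₂)` removes the dependence on `z₂`. -/
theorem deriv_rif {n : ℕ} {p : ℂ[X][Y]} (hp : IsRIFDenominator n p)
    {τ lam β : Circle} {s : ℝ} (h : IsSingularity n p τ lam β s) {z₂ : ℂ} (hz : z₂ ≠ lam) :
    deriv (fun z₁ => rif n p (z₁, z₂)) τ = s * β * conj (τ : ℂ) := by
  have hne := evalEval_ne_zero_of_ne h hz
  have h1 := (((reflection n (p.coeff 1)).hasDerivAt (τ : ℂ)).add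
    (((reflection n (p.coeff 0)).hasDerivAt (τ : ℂ)).const_mul z₂)).div
    (((p.coeff 0).hasDerivAt (τ : ℂ)).add (((p.coeff 1).hasDerivAt (τ : ℂ)).const_mul z₂)) hne
  have h2 : (fun z₁ => rif n p (z₁, z₂)) = fun z₁ =>
      ((reflection n (p.coeff 1)).eval z₁ + z₂ * (reflection n (p.coeff 0)).eval z₁) /
        ((p.coeff 0).eval z₁ + z₂ * (p.coeff 1).eval z₁) := by
    ext z₁
    simp only [rif, hp.evalEval_eq, evalEval_biReflection]
  rw [h2]
  refine HasDerivAt.deriv (h1.congr_deriv ?_)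
  simp only [Pi.add_apply]
  rw [div_eq_iff (pow_ne_zero 2 hne), h.reflection_coeff_zero, h.reflection_coeff_one]
  linear_combination ((p.coeff 0).eval (τ : ℂ) + z₂ * (p.coeff 1).eval (τ : ℂ)) *
    (h.derivative_coeff_one + z₂ * h.derivative_coeff_zero)

theorem HasNontangentialValue.unique {φ : ℂ × ℂ → ℂ} {ζ : Circle × Circle} {β β' : ℂ}
    (h : HasNontangentialValue φ ζ β) (h' : HasNontangentialValue φ ζ β') : β = β' := by
  -- Limits are unique once the filter is nontrivial: the radius `r ↦ (r ζ₁, r ζ₂)` runs inside the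
  -- region of aperture `2`.
  have hne : (𝓝[stolzRegion 2 ζ] ((ζ.1 : ℂ), (ζ.2 : ℂ))).NeBot := by
    have ht : Tendsto (fun r : ℝ => ((r : ℂ) * (ζ.1 : ℂ), (r : ℂ) * (ζ.2 : ℂ))) (𝓝[<] 1)
        (𝓝[stolzRegion 2 ζ] ((ζ.1 : ℂ), (ζ.2 : ℂ))) := by
      refine tendsto_nhdsWithin_iff.2 ⟨?_, ?_⟩
      · have : Continuous fun r : ℝ => ((r : ℂ) * (ζ.1 : ℂ), (r : ℂ) * (ζ.2 : ℂ)) := by fun_prop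
        have := this.tendsto 1
        simp only [Complex.ofReal_one, one_mul] at this
        exact this.mono_left nhdsWithin_le_nhds
      · have h0 : ∀ᶠ r : ℝ in 𝓝[<] 1, 0 < r :=
          (lt_mem_nhds one_pos).filter_mono nhdsWithin_le_nhds
        filter_upwards [h0, self_mem_nhdsWithin] with r hr0 hr1
        have hr1 : r < 1 := hr1
        have key : ∀ ξ : Circle, ‖(r : ℂ) * (ξ : ℂ) - ξ‖ < 2 * (1 - ‖(r : ℂ) * (ξ : ℂ)‖) := by
          intro ξ
          have e : (r : ℂ) * (ξ : ℂ) - ξ = ((r - 1 : ℝ) : ℂ) * ξ := by push_cast; ring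
          rw [e, norm_mul, norm_mul, Circle.norm_coe, Complex.norm_real, Complex.norm_real,
            Real.norm_of_nonneg hr0.le, Real.norm_of_nonpos (by linarith)]
          linarith
        exact ⟨key _, key _⟩
    exact ht.neBot
  exact tendsto_nhds_unique (h 2 (by norm_num)) (h' 2 (by norm_num))

theorem exists_eval_eq_sub_mul_of_root {q : ℂ[X]} {a : ℂ} (h : q.eval a = 0) :
    ∃ r : ℂ[X], (∀ z, q.eval z = (z - a) * r.eval z) ∧ r.eval a = (derivative q).eval a := by
  obtain ⟨r, rfl⟩ := dvd_iff_isRoot.2 h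
  exact ⟨r, fun z => by simp, by simp [derivative_mul]⟩

/-- `φ - β = (z₁ - τ) R / p` with `R(τ, lam) = 0`. In a Stolz region `|z₁ - τ| ≤ M (1 - |z₁|)`,
while `|p| ≥ c (1 - |z₁|) |p₁|`, so `φ - β` is `O(R)`. -/
theorem hasNontangentialValue_rif {n : ℕ} {p : ℂ[X][Y]} (hp : IsRIFDenominator n p)
    {τ lam β : Circle} {s : ℝ} (h : IsSingularity n p τ lam β s) :
    HasNontangentialValue (rif n p) (τ, lam) β := by
  intro M hM
  obtain ⟨r₂, hr₂, hr₂'⟩ := exists_eval_eq_sub_mul_of_root (a := (τ : ℂ))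
    (q := reflection n (p.coeff 0) - C (β : ℂ) * p.coeff 1) (by simp [h.reflection_coeff_zero])
  obtain ⟨r₁, hr₁, hr₁'⟩ := exists_eval_eq_sub_mul_of_root (a := (τ : ℂ))
    (q := reflection n (p.coeff 1) - C (β : ℂ) * p.coeff 0) (by simp [h.reflection_coeff_one])
  simp only [derivative_sub, derivative_C_mul, eval_sub, eval_mul, eval_C,
    h.derivative_coeff_zero, h.derivative_coeff_one] at hr₁ hr₂ hr₁' hr₂'
  obtain ⟨c, hc, hbd⟩ := hp.exists_norm_coeff_one_le
  let R : ℂ × ℂ → ℂ := fun z => r₁.eval z.1 + z.2 * r₂.eval z.1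
  have hRcont : Continuous R := by
    have h1 := r₁.continuous
    have h2 := r₂.continuous
    fun_prop
  have hR0 : R (τ, lam) = 0 := by
    simp only [R, hr₁', hr₂', h.coeff_zero]
    ring
  have hp0 := hp.coeff_zero_eval_circle_ne_zero τ
  have hbound : ∀ z ∈ stolzRegion M (τ, lam),
      ‖rif n p z - β‖ ≤ M / c * ‖R z‖ / ‖(p.coeff 0).eval z.1‖ := by
    rintro ⟨z₁, z₂⟩ ⟨h1, h2⟩
    simp only at h1 h2 ⊢
    have hz₁ : ‖z₁‖ < 1 := by
      have := (norm_nonneg _).trans_lt h1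
      have := pos_of_mul_pos_right this (by linarith)
      linarith
    have hz₂ : ‖z₂‖ < 1 := by
      have := (norm_nonneg _).trans_lt h2
      have := pos_of_mul_pos_right this (by linarith)
      linarith
    have hpne := hp.evalEval_ne_zero z₁ z₂ hz₁ hz₂
    have hp1 := norm_pos_iff.2 (hp.coeff_zero_eval_ne_zero_of_mem_ball hz₁)
    have e : rif n p (z₁, z₂) - β = (z₁ - τ) * R (z₁, z₂) / p.evalEval z₁ z₂ := by
      simp only [rif, R]
      rw [div_sub' hpne, evalEval_biReflection, hp.evalEval_eq]
      congr 1
      linear_combination hr₁ z₁ + z₂ * hr₂ z₁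
    have hlow : c * (1 - ‖z₁‖) * ‖(p.coeff 0).eval z₁‖ ≤ ‖p.evalEval z₁ z₂‖ := by
      refine (hbd z₁ hz₁).trans ?_
      rw [hp.evalEval_eq]
      have h3 : ‖z₂ * (p.coeff 1).eval z₁‖ ≤ ‖(p.coeff 1).eval z₁‖ := by
        rw [norm_mul]
        exact mul_le_of_le_one_left (norm_nonneg _) hz₂.le
      have h4 := norm_sub_norm_le ((p.coeff 0).eval z₁) (-(z₂ * (p.coeff 1).eval z₁))
      rw [norm_neg, sub_neg_eq_add] at h4
      linarith
    rw [e, norm_div, norm_mul, div_le_div_iff₀ (norm_pos_iff.2 hpne) hp1]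
    have h5 : M / c * ‖R (z₁, z₂)‖ * (c * (1 - ‖z₁‖) * ‖(p.coeff 0).eval z₁‖) ≤
        M / c * ‖R (z₁, z₂)‖ * ‖p.evalEval z₁ z₂‖ :=
      mul_le_mul_of_nonneg_left hlow (by positivity)
    refine le_trans ?_ h5
    have h6 : M / c * ‖R (z₁, z₂)‖ * (c * (1 - ‖z₁‖) * ‖(p.coeff 0).eval z₁‖) =
        M * (1 - ‖z₁‖) * ‖R (z₁, z₂)‖ * ‖(p.coeff 0).eval z₁‖ := by field_simp
    rw [h6]
    gcongr
  rw [tendsto_iff_norm_sub_tendsto_zero]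
  refine squeeze_zero' (Eventually.of_forall fun _ => norm_nonneg _)
    (eventually_nhdsWithin_of_forall hbound) ?_
  have hlim : ContinuousAt (fun z : ℂ × ℂ => M / c * ‖R z‖ / ‖(p.coeff 0).eval z.1‖)
      ((τ : ℂ), (lam : ℂ)) := by
    have h1 := (p.coeff 0).continuous
    exact ContinuousAt.div (by fun_prop) (by fun_prop) (by simpa using hp0)
  have := hlim.tendsto
  simp only [hR0, norm_zero, mul_zero, zero_div] at this
  exact this.mono_left nhdsWithin_le_nhds

theorem hasNontangentialValue_rif_iff {n : ℕ} {p : ℂ[X][Y]} (hp : IsRIFDenominator n p)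
    {τ lam β : Circle} {s : ℝ} (h : IsSingularity n p τ lam β s) (α : Circle) :
    HasNontangentialValue (rif n p) (τ, lam) α ↔ β = α := by
  refine ⟨fun hα => Circle.ext ((hasNontangentialValue_rif hp h).unique hα), ?_⟩
  rintro rfl
  exact hasNontangentialValue_rif hp h

/-! ### Finite Blaschke products and the function `B_α`. -/

theorem _root_.RatFunc.eval_algebraMap_div_algebraMap {K : Type*} [Field K] (P Q : K[X]) {x : K}
    (hx : Q.eval x ≠ 0) :
    (algebraMap K[X] (RatFunc K) P / algebraMap K[X] (RatFunc K) Q).eval (RingHom.id K) x =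
      P.eval x / Q.eval x := by
  have hQ : Q ≠ 0 := fun h => hx (by simp [h])
  set f := algebraMap K[X] (RatFunc K) P / algebraMap K[X] (RatFunc K) Q with hf
  obtain ⟨R, hR⟩ := RatFunc.denom_div_dvd P Q
  have hd : f.denom.eval x ≠ 0 := fun h => hx (by rw [hR, eval_mul, ← hf, h, zero_mul])
  have h1 : f.num * Q = P * f.denom := by
    have h2 := RatFunc.num_div_denom f
    have h3 : algebraMap K[X] (RatFunc K) Q ≠ 0 := by simpa using hQ
    have h4 : algebraMap K[X] (RatFunc K) f.denom ≠ 0 := by simpa using f.denom_ne_zero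
    rw [hf, ← hf, div_eq_iff h4] at h2
    refine RatFunc.algebraMap_injective K ?_
    rw [map_mul, map_mul, h2, hf]
    field_simp
  have h5 := congrArg (Polynomial.eval x) h1
  rw [eval_mul, eval_mul] at h5
  rw [RatFunc.eval, eval₂_id, eval₂_id, div_eq_div_iff hd hx, h5]

theorem isFiniteBlaschkeProduct_C (γ : Circle) :
    IsFiniteBlaschkeProduct (RatFunc.C (γ : ℂ)) :=
  ⟨γ, 0, Fin.elim0, fun j => j.elim0, by simp⟩

theorem IsFiniteBlaschkeProduct.C_mul {B : RatFunc ℂ} (hB : IsFiniteBlaschkeProduct B)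
    (γ : Circle) : IsFiniteBlaschkeProduct (RatFunc.C (γ : ℂ) * B) := by
  obtain ⟨γ', d, a, ha, rfl⟩ := hB
  exact ⟨γ * γ', d, a, ha, by rw [Circle.coe_mul, map_mul, mul_assoc]⟩

/-- The elementary factor `(z - a) / (1 - conj a z)`, which is constant when `|a| = 1`. -/
theorem IsFiniteBlaschkeProduct.factor_mul {B : RatFunc ℂ} (hB : IsFiniteBlaschkeProduct B)
    {a : ℂ} (ha : ‖a‖ ≤ 1) :
    IsFiniteBlaschkeProduct
      ((RatFunc.X - RatFunc.C a) / (1 - RatFunc.C (conj a) * RatFunc.X) * B) := by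
  rcases ha.lt_or_eq with h | h
  · obtain ⟨γ, d, b, hb, rfl⟩ := hB
    refine ⟨γ, d + 1, Fin.cons a b, fun j => ?_, ?_⟩
    · refine Fin.cases (by simpa using h) (fun i => by simpa using hb i) j
    · rw [Fin.prod_univ_succ]
      simp only [Fin.cons_zero, Fin.cons_succ]
      ring
  · have h1 : a * conj a = 1 := by rw [Complex.mul_conj', h]; simp
    have h2 : (RatFunc.X - RatFunc.C a) / (1 - RatFunc.C (conj a) * RatFunc.X) =
        RatFunc.C (-a) := by
      have h3 : RatFunc.C a * RatFunc.C (conj a) = (1 : RatFunc ℂ) := by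
        rw [← map_mul, h1, map_one]
      have h4 : (1 : RatFunc ℂ) - RatFunc.C (conj a) * RatFunc.X ≠ 0 := by
        have h5 : (1 : RatFunc ℂ) - RatFunc.C (conj a) * RatFunc.X =
            algebraMap ℂ[X] (RatFunc ℂ) (1 - C (conj a) * X) := by simp
        rw [h5, Ne, FaithfulSMul.algebraMap_eq_zero_iff]
        intro h6
        simpa using congrArg (Polynomial.eval 0) h6
      rw [div_eq_iff h4, map_neg]
      linear_combination (-RatFunc.X) * h3
    rw [h2]
    exact hB.C_mul ⟨-a, by simpa [Submonoid.unitSphere] using h⟩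

/-- Roots on the circle are allowed: their factors are unimodular constants, which is how the common
zeros of `N` and `D` cancel. -/
theorem isFiniteBlaschkeProduct_multiset_prod (s : Multiset ℂ) (hs : ∀ a ∈ s, ‖a‖ ≤ 1) :
    IsFiniteBlaschkeProduct (s.map fun a =>
      (RatFunc.X - RatFunc.C a) / (1 - RatFunc.C (conj a) * RatFunc.X)).prod := by
  induction s using Multiset.induction with
  | empty => simpa using isFiniteBlaschkeProduct_C 1
  | cons a s ih =>
    rw [Multiset.map_cons, Multiset.prod_cons]
    exact (ih fun b hb => hs b (Multiset.mem_cons_of_mem hb)).factor_mul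
      (hs a (Multiset.mem_cons_self a s))

/-- A finite Blaschke product restricts to a continuous self-map of the unit circle. -/
theorem IsFiniteBlaschkeProduct.exists_continuous {B : RatFunc ℂ}
    (hB : IsFiniteBlaschkeProduct B) :
    ∃ b : Circle → Circle, Continuous b ∧
      ∀ ζ : Circle, (b ζ : ℂ) = B.eval (RingHom.id ℂ) (ζ : ℂ) := by
  obtain ⟨γ, d, a, ha, rfl⟩ := hB
  have hne : ∀ (j : Fin d) (ζ : Circle), 1 - conj (a j) * (ζ : ℂ) ≠ 0 := by
    intro j ζ h
    have h1 : ‖conj (a j) * (ζ : ℂ)‖ = 1 := by rw [← sub_eq_zero.1 h, norm_one]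
    rw [norm_mul, Complex.norm_conj, Circle.norm_coe, mul_one] at h1
    exact (ha j).ne h1
  set P : ℂ[X] := C (γ : ℂ) * ∏ j, (X - C (a j))
  set Q : ℂ[X] := ∏ j, (1 - C (conj (a j)) * X)
  have hQ : ∀ ζ : Circle, Q.eval (ζ : ℂ) ≠ 0 := fun ζ => by
    simp only [Q, eval_prod]
    exact Finset.prod_ne_zero_iff.2 fun j _ => by simpa using hne j ζ
  have hPQ : ∀ ζ : Circle, ‖P.eval (ζ : ℂ) / Q.eval (ζ : ℂ)‖ = 1 := fun ζ => by
    rw [norm_div, div_eq_one_iff_eq (norm_ne_zero_iff.2 (hQ ζ))]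
    simp only [P, Q, eval_mul, eval_C, eval_prod, norm_mul, norm_prod, Circle.norm_coe, one_mul]
    refine Finset.prod_congr rfl fun j _ => ?_
    simp only [eval_sub, eval_X, eval_C, eval_one, eval_mul]
    have h1 := Circle.coe_mul_conj ζ
    calc ‖(ζ : ℂ) - a j‖ = ‖(ζ : ℂ) * conj (1 - conj (a j) * (ζ : ℂ))‖ := by
          congr 1
          simp only [map_sub, map_one, map_mul, Complex.conj_conj]
          linear_combination (a j) * h1
      _ = _ := by rw [norm_mul, Circle.norm_coe, one_mul, Complex.norm_conj]
  refine ⟨fun ζ => ⟨P.eval (ζ : ℂ) / Q.eval (ζ : ℂ), by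
    simpa [Submonoid.unitSphere] using hPQ ζ⟩, ?_, fun ζ => ?_⟩
  · refine Continuous.subtype_mk ?_ _
    have hc : Continuous fun ζ : Circle => (ζ : ℂ) := by fun_prop
    exact (P.continuous.comp hc).div (Q.continuous.comp hc) hQ
  · have h1 : RatFunc.C (γ : ℂ) * ∏ j, (RatFunc.X - RatFunc.C (a j)) /
        (1 - RatFunc.C (conj (a j)) * RatFunc.X) =
        algebraMap ℂ[X] (RatFunc ℂ) P / algebraMap ℂ[X] (RatFunc ℂ) Q := by
      simp [P, Q, Finset.prod_div_distrib, mul_div_assoc, map_prod]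
    rw [h1, RatFunc.eval_algebraMap_div_algebraMap P Q (hQ ζ)]

theorem reflection_prod_X_sub_C (s : Multiset ℂ) :
    reflection s.card (s.map fun a => X - C a).prod =
      (s.map fun a => 1 - C (conj a) * X).prod := by
  induction s using Multiset.induction with
  | empty => simp [reflection]
  | cons a s ih =>
    rw [Multiset.map_cons, Multiset.prod_cons, Multiset.map_cons, Multiset.prod_cons,
      Multiset.card_cons, add_comm, reflection_mul (natDegree_X_sub_C_le a) (by simp), ih]
    congr 1
    simp [reflection, reflect_sub, reflect_C]

/-- The numerator `p̃₁ - α p₂` of `B_α`. -/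
def bNum (n : ℕ) (p : ℂ[X][Y]) (α : Circle) : ℂ[X] :=
  reflection n (p.coeff 0) - C (α : ℂ) * p.coeff 1

/-- The denominator `α p₁ - p̃₂` of `B_α`. -/
def bDen (n : ℕ) (p : ℂ[X][Y]) (α : Circle) : ℂ[X] :=
  C (α : ℂ) * p.coeff 0 - reflection n (p.coeff 1)

theorem bDen_eq (n : ℕ) (p : ℂ[X][Y]) (α : Circle) :
    bDen n p α = C (α : ℂ) * reflection n (bNum n p α) := by
  have h3 : C (α : ℂ) * C (conj (α : ℂ)) = 1 := by rw [← C_mul, Circle.coe_mul_conj, C_1]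
  rw [bDen, bNum, reflection_sub, reflection_reflection, reflection_C_mul]
  linear_combination reflection n (p.coeff 1) * h3

namespace IsRIFDenominator

variable {n : ℕ} {p : ℂ[X][Y]}

theorem natDegree_bNum_le (hp : IsRIFDenominator n p) (α : Circle) :
    (bNum n p α).natDegree ≤ n :=
  (natDegree_sub_le _ _).trans (max_le (natDegree_reflection_le (hp.natDegree_coeff_le 0))
    ((natDegree_C_mul_le _ _).trans (hp.natDegree_coeff_le 1)))

theorem norm_bDen_eval (hp : IsRIFDenominator n p) (α ζ : Circle) :
    ‖(bDen n p α).eval (ζ : ℂ)‖ = ‖(bNum n p α).eval (ζ : ℂ)‖ := by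
  rw [bDen_eq, eval_mul, eval_C, norm_mul, Circle.norm_coe, one_mul,
    norm_eval_reflection (hp.natDegree_bNum_le α)]

/-- A zero would give `p̃₂ / p₁` the unimodular value `α` inside the disk, where its modulus is
strictly below one. -/
theorem bDen_eval_ne_zero (hp : IsRIFDenominator n p) (α : Circle) {z : ℂ} (hz : ‖z‖ < 1) :
    (bDen n p α).eval z ≠ 0 := by
  intro h
  obtain ⟨c, hc, hbd⟩ := hp.exists_norm_div_le
    (fun z hz => hp.norm_reflection_coeff_one_le hz.le) hp.reflection_coeff_one_ne_C_mul
  simp only [bDen, eval_sub, eval_mul, eval_C] at h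
  have h1 := hbd z hz
  rw [← sub_eq_zero.1 h, mul_div_cancel_right₀ _ (hp.coeff_zero_eval_ne_zero hz.le),
    Circle.norm_coe] at h1
  have := mul_pos hc (sub_pos.2 hz)
  linarith

/-- The factorizations of the numerator and denominator of `B_α`. -/
theorem exists_bNum_eq_prod (hp : IsRIFDenominator n p) (α : Circle) :
    ∃ (c : ℂ) (s : Multiset ℂ), c ≠ 0 ∧ (∀ a ∈ s, ‖a‖ ≤ 1) ∧
      bNum n p α = C c * (s.map fun a => X - C a).prod ∧
      bDen n p α = C (α * conj c) * (s.map fun a => 1 - C (conj a) * X).prod := by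
  set N := bNum n p α with hN
  -- `D(0)` is `α` times the conjugate of the coefficient of `z ^ n` in `N`. So `N` has degree
  -- exactly `n`, and reflecting at degree `n` turns each root factor into `1 - ā z` with no power
  -- of `z` left over.
  have hlead : N.coeff n ≠ 0 := fun h => by
    have h1 := hp.bDen_eval_ne_zero α (z := 0) (by simp)
    rw [bDen_eq, eval_mul, ← coeff_zero_eq_eval_zero (reflection n _), coeff_reflection_zero,
      ← hN, h] at h1
    simp at h1
  have hdeg : N.natDegree = n :=
    le_antisymm (hp.natDegree_bNum_le α) (le_natDegree_of_ne_zero hlead)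
  have hN0 : N ≠ 0 := fun h => hlead (by simp [h])
  have hsplit := IsAlgClosed.splits N
  have hcard : N.roots.card = n := by rw [← hdeg]; exact hsplit.natDegree_eq_card_roots.symm
  have e1 : N = C N.leadingCoeff * (N.roots.map fun a => X - C a).prod :=
    hsplit.eq_prod_roots
  have e2 : bDen n p α = C (α * conj N.leadingCoeff) *
      (N.roots.map fun a => 1 - C (conj a) * X).prod := by
    rw [bDen_eq, ← hN]
    conv_lhs => rw [e1]
    rw [reflection_C_mul, ← reflection_prod_X_sub_C, hcard, C_mul, mul_assoc]
  refine ⟨N.leadingCoeff, N.roots, leadingCoeff_ne_zero.2 hN0, fun a ha => ?_, e1, e2⟩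
  -- A root `a` of `N` outside the closed disk would give the root `1 / ā` of `D` inside the open
  -- disk.
  by_contra! hlt
  have ha0 : a ≠ 0 := norm_pos_iff.1 (one_pos.trans hlt)
  refine hp.bDen_eval_ne_zero α (z := (conj a)⁻¹) ?_ ?_
  · rw [norm_inv, Complex.norm_conj]
    exact inv_lt_one_of_one_lt₀ hlt
  · rw [e2, eval_mul, eval_multiset_prod, Multiset.map_map]
    refine mul_eq_zero_of_right _ (Multiset.prod_eq_zero (Multiset.mem_map.2 ⟨a, ha, ?_⟩))
    simp [ha0]

theorem isFiniteBlaschkeProduct_bAlpha (hp : IsRIFDenominator n p) (α : Circle) :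
    IsFiniteBlaschkeProduct (bAlpha n p α) := by
  obtain ⟨c, s, hc, hs, e1, e2⟩ := hp.exists_bNum_eq_prod α
  have hγ : ‖c / (α * conj c)‖ = 1 := by
    rw [norm_div, norm_mul, Circle.norm_coe, Complex.norm_conj, one_mul,
      div_self (norm_ne_zero_iff.2 hc)]
  have h := (isFiniteBlaschkeProduct_multiset_prod s hs).C_mul
    ⟨c / (α * conj c), by simpa [Submonoid.unitSphere] using hγ⟩
  convert h using 1
  change algebraMap ℂ[X] (RatFunc ℂ) (bNum n p α) / algebraMap ℂ[X] (RatFunc ℂ) (bDen n p α) = _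
  rw [e1, e2, Multiset.prod_map_div, map_mul, map_mul, map_multiset_prod, map_multiset_prod,
    Multiset.map_map, Multiset.map_map, RatFunc.algebraMap_C, RatFunc.algebraMap_C,
    mul_div_mul_comm, ← map_div₀]
  simp [Function.comp_def]

theorem norm_bNum_eval_le (hp : IsRIFDenominator n p) (α : Circle) {z : ℂ} (hz : ‖z‖ ≤ 1) :
    ‖(bNum n p α).eval z‖ ≤ ‖(bDen n p α).eval z‖ := by
  obtain ⟨c, s, hc, hs, e1, e2⟩ := hp.exists_bNum_eq_prod α
  rw [e1, e2, eval_mul, eval_mul, norm_mul, norm_mul, eval_C, eval_C, norm_mul, Circle.norm_coe,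
    Complex.norm_conj, one_mul]
  refine mul_le_mul_of_nonneg_left ?_ (norm_nonneg _)
  clear e1 e2
  induction s using Multiset.induction with
  | empty => simp
  | cons a s ih =>
    simp only [Multiset.map_cons, Multiset.prod_cons, eval_mul, norm_mul]
    refine mul_le_mul ?_ (ih fun b hb => hs b (Multiset.mem_cons_of_mem hb)) (norm_nonneg _)
      (norm_nonneg _)
    have ha := hs a (Multiset.mem_cons_self a s)
    simp only [eval_sub, eval_X, eval_C, eval_one, eval_mul]
    refine (sq_le_sq₀ (norm_nonneg _) (norm_nonneg _)).1 (sub_nonneg.1 ?_)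
    have hid : ‖1 - conj a * z‖ ^ 2 - ‖z - a‖ ^ 2 = (1 - ‖a‖ ^ 2) * (1 - ‖z‖ ^ 2) := by
      simp only [Complex.sq_norm, Complex.normSq_apply, Complex.sub_re, Complex.sub_im,
        Complex.mul_re, Complex.mul_im, Complex.conj_re, Complex.conj_im, Complex.one_re,
        Complex.one_im]
      ring
    rw [hid]
    exact mul_nonneg (sub_nonneg.2 (pow_le_one₀ (norm_nonneg _) ha))
      (sub_nonneg.2 (pow_le_one₀ (norm_nonneg _) hz))

/-- `α p - p̃ = D - z₂ N` vanishes on `𝔻̄ × 𝔻` only where `D` vanishes. -/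
theorem bDen_sub_mul_bNum_ne_zero (hp : IsRIFDenominator n p) (α : Circle) {z₁ z₂ : ℂ}
    (hz₁ : ‖z₁‖ ≤ 1) (hz₂ : ‖z₂‖ < 1) (hD : (bDen n p α).eval z₁ ≠ 0) :
    (bDen n p α).eval z₁ - z₂ * (bNum n p α).eval z₁ ≠ 0 := by
  intro h
  have h1 := congrArg norm (sub_eq_zero.1 h)
  rw [norm_mul] at h1
  have h2 := hp.norm_bNum_eval_le α hz₁
  have h3 := norm_pos_iff.2 hD
  nlinarith [norm_nonneg z₂]

theorem wAlpha_nonneg (hp : IsRIFDenominator n p) (α ζ : Circle) : 0 ≤ wAlpha n p α ζ := by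
  refine div_nonneg (sub_nonneg.2 ?_) (sq_nonneg _)
  exact pow_le_pow_left₀ (norm_nonneg _) (hp.norm_coeff_one_le (Circle.norm_coe ζ).le) 2

end IsRIFDenominator

/-! ### Lebesgue measure and Poisson formulas on the circle. -/

instance isProbabilityMeasure_circleMeasure : IsProbabilityMeasure circleMeasure := by
  constructor
  rw [circleMeasure, Measure.smul_apply, Measure.map_apply (by fun_prop) MeasurableSet.univ,
    Set.preimage_univ, Measure.restrict_apply_univ, Real.volume_Ioc, sub_zero, smul_eq_mul,
    ← ENNReal.ofReal_mul (by positivity), inv_mul_cancel₀ (by positivity), ENNReal.ofReal_one]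

instance nullSingletonClass_circleMeasure : NullSingletonClass circleMeasure := by
  constructor
  intro τ
  rw [circleMeasure, Measure.smul_apply,
    Measure.map_apply (by fun_prop) (measurableSet_singleton τ)]
  have hc : (Circle.exp ⁻¹' {τ}).Countable := by
    obtain ⟨θ, rfl⟩ : ∃ θ, Circle.exp θ = τ := ⟨_, Circle.exp_arg τ⟩
    refine (Set.countable_range fun k : ℤ => θ + k * (2 * Real.pi)).mono fun t ht => ?_
    have ht : Circle.exp t = Circle.exp θ := ht
    have h1 : Circle.exp (t - θ) = 1 := by rw [Circle.exp_sub, ht, div_self']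
    obtain ⟨k, hk⟩ := Circle.exp_eq_one.1 h1
    exact ⟨k, by simp only; linarith⟩
  rw [hc.measure_zero, smul_zero]

theorem integrable_of_continuous {X E : Type*} [TopologicalSpace X] [CompactSpace X] [T2Space X]
    [MeasurableSpace X] [OpensMeasurableSpace X] [NormedAddCommGroup E]
    [SecondCountableTopologyEither X E] (μ : Measure X) [IsFiniteMeasure μ] {f : X → E}
    (hf : Continuous f) : Integrable f μ := by
  rw [← integrableOn_univ]
  exact hf.continuousOn.integrableOn_compact isCompact_univ

theorem integral_circleMeasure {F : ℂ → ℂ} (hF : Continuous fun ζ : Circle => F ζ) :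
    ∫ ζ : Circle, F ζ ∂circleMeasure = Real.circleAverage F 0 1 := by
  rw [circleMeasure, integral_smul_measure, integral_map (by fun_prop)
    hF.aestronglyMeasurable, Real.circleAverage_def,
    intervalIntegral.integral_of_le (by positivity), ENNReal.toReal_ofReal (by positivity)]
  simp [circleMap]

/-- The Poisson kernel of the disk. -/
def diskKernel (z : ℂ) (ζ : Circle) : ℝ := (1 - ‖z‖ ^ 2) / ‖(ζ : ℂ) - z‖ ^ 2

theorem poissonKernel_eq_mul (z : ℂ × ℂ) (ζ : Circle × Circle) :
    poissonKernel z ζ = diskKernel z.1 ζ.1 * diskKernel z.2 ζ.2 := by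
  rw [poissonKernel, diskKernel, diskKernel, div_mul_div_comm]

theorem re_add_div_sub (a b : ℂ) : ((a + b) / (a - b)).re = (‖a‖ ^ 2 - ‖b‖ ^ 2) / ‖a - b‖ ^ 2 := by
  have := congrFun (poissonKernel_eq_re_herglotzRieszKernel (c := 0) (w := b)) a
  simpa [_root_.poissonKernel, herglotzRieszKernel] using this.symm

theorem diskKernel_eq_re (z : ℂ) (ζ : Circle) :
    diskKernel z ζ = (((ζ : ℂ) + z) / ((ζ : ℂ) - z)).re := by
  rw [re_add_div_sub, Circle.norm_coe, one_pow, diskKernel]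

theorem Circle.coe_sub_ne_zero {z : ℂ} (hz : ‖z‖ < 1) (ζ : Circle) : (ζ : ℂ) - z ≠ 0 := fun h => by
  rw [← sub_eq_zero.1 h, Circle.norm_coe] at hz
  exact lt_irrefl _ hz

theorem continuous_diskKernel {X : Type*} [TopologicalSpace X] {z : X → ℂ} {ζ : X → Circle}
    (hz : Continuous z) (hζ : Continuous ζ) (h : ∀ x, ‖z x‖ < 1) :
    Continuous fun x => diskKernel (z x) (ζ x) := by
  unfold diskKernel
  refine Continuous.div (by fun_prop) (by fun_prop) fun x => ?_
  exact pow_ne_zero 2 (norm_ne_zero_iff.2 (Circle.coe_sub_ne_zero (h x) _))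

theorem continuous_of_diffContOnCl {G : ℂ → ℂ} (hG : DiffContOnCl ℂ G (Metric.ball 0 1)) :
    Continuous fun ζ : Circle => G ζ := by
  have h1 := hG.continuousOn
  rw [closure_ball _ one_ne_zero] at h1
  exact h1.comp_continuous (by fun_prop) fun ζ => by simp [Circle.norm_coe]

/-- The Poisson formula on the disk. -/
theorem integral_diskKernel_mul {G : ℂ → ℂ} (hG : DiffContOnCl ℂ G (Metric.ball 0 1)) {z : ℂ}
    (hz : ‖z‖ < 1) : ∫ ζ : Circle, (diskKernel z ζ : ℂ) * G ζ ∂circleMeasure = G z := by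
  have h1 := hG.circleAverage_poissonKernel_smul (w := z) (by simpa using hz)
  have hc := (Complex.continuous_ofReal.comp
    (continuous_diskKernel (continuous_const (y := z)) continuous_id fun _ => hz)).mul
    (continuous_of_diffContOnCl hG)
  have h2 : ∀ ζ : Circle, (diskKernel z ζ : ℂ) * G ζ =
      (_root_.poissonKernel 0 z • G) ζ := fun ζ => by
    simp [_root_.poissonKernel, diskKernel, Circle.norm_coe]
  rw [← h1, ← integral_circleMeasure]
  · exact integral_congr_ae (Eventually.of_forall h2)
  · exact hc.congr h2

theorem integral_diskKernel_mul_re {G : ℂ → ℂ} (hG : DiffContOnCl ℂ G (Metric.ball 0 1)) {z : ℂ}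
    (hz : ‖z‖ < 1) : ∫ ζ : Circle, diskKernel z ζ * (G ζ).re ∂circleMeasure = (G z).re := by
  have hc := (Complex.continuous_ofReal.comp
    (continuous_diskKernel (continuous_const (y := z)) continuous_id fun _ => hz)).mul
    (continuous_of_diffContOnCl hG)
  have h1 := Complex.reCLM.integral_comp_comm (integrable_of_continuous circleMeasure hc)
  have h2 := integral_diskKernel_mul hG hz
  rw [← h2]
  refine Eq.trans ?_ h1
  refine integral_congr_ae (Eventually.of_forall fun ζ => ?_)
  simp

theorem integral_diskKernel {z : ℂ} (hz : ‖z‖ < 1) :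
    ∫ ζ : Circle, diskKernel z ζ ∂circleMeasure = 1 := by
  simpa using integral_diskKernel_mul_re (G := fun _ => 1) diffContOnCl_const hz

/-- The Poisson formula for a rational function `U / H` whose only poles in the closed disk are
simple poles on the circle, with residues that make it `c τ (τ + z) / (τ - z)` near each of them. -/
theorem poisson_formula_of_simple_poles {U H : ℂ[X]} {S : Finset Circle} {c w : Circle → ℝ}
    (hH : ∀ z : ℂ, ‖z‖ ≤ 1 → (∀ τ ∈ S, z ≠ τ) → H.eval z ≠ 0)
    (hS : ∀ τ ∈ S, H.eval (τ : ℂ) = 0) (hS' : ∀ τ ∈ S, (derivative H).eval (τ : ℂ) ≠ 0)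
    (hU : ∀ τ ∈ S, U.eval (τ : ℂ) = -2 * c τ * τ * (derivative H).eval (τ : ℂ))
    (hw : ∀ ζ ∉ S, w ζ = (U.eval (ζ : ℂ) / H.eval (ζ : ℂ)).re) :
    Integrable w circleMeasure ∧ ∀ z : ℂ, ‖z‖ < 1 →
      (U.eval z / H.eval z).re =
        ∫ ζ, diskKernel z ζ * w ζ ∂circleMeasure + ∑ τ ∈ S, c τ * diskKernel z τ := by
  classical
  have hK : ∀ τ : Circle, ∃ K : ℂ[X], τ ∈ S →
      H = (X - C (τ : ℂ)) * K ∧ K.eval (τ : ℂ) = (derivative H).eval (τ : ℂ) := by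
    intro τ
    by_cases hτ : τ ∈ S
    · obtain ⟨K, hK⟩ := dvd_iff_isRoot.2 (hS τ hτ)
      refine ⟨K, fun _ => ⟨hK, ?_⟩⟩
      rw [hK]; simp [derivative_mul]
    · exact ⟨0, fun h => (hτ h).elim⟩
  choose K hK using hK
  -- With `H = (z - τ) K τ`, `P / H` equals `U / H - ∑ c (τ + z) / (τ - z)`. The condition `hU`
  -- makes `P` vanish on `S`, so the poles cancel.
  set P : ℂ[X] := U + ∑ τ ∈ S, C (c τ : ℂ) * (X + C (τ : ℂ)) * K τ with hP
  set Z : ℂ[X] := ∏ τ ∈ S, (X - C (τ : ℂ)) with hZ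
  have hcop : (S : Set Circle).Pairwise
      (Function.onFun IsCoprime fun τ : Circle => X - C (τ : ℂ)) := fun a _ b _ hab =>
    pairwise_coprime_X_sub_C (s := fun τ : Circle => (τ : ℂ)) (fun _ _ h => Circle.ext h) hab
  have hdvd : ∀ Q : ℂ[X], (∀ τ ∈ S, Q.eval (τ : ℂ) = 0) → Z ∣ Q := fun Q hQ =>
    Finset.prod_dvd_of_coprime hcop fun τ hτ => dvd_iff_isRoot.2 (hQ τ hτ)
  obtain ⟨H₁, hH₁⟩ := hdvd H hS
  obtain ⟨P₁, hP₁⟩ := hdvd P fun τ hτ => by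
    have hsum : ∑ i ∈ S, (C (c i : ℂ) * (X + C (i : ℂ)) * K i).eval (τ : ℂ) =
        (C (c τ : ℂ) * (X + C (τ : ℂ)) * K τ).eval (τ : ℂ) := by
      refine Finset.sum_eq_single τ (fun i hi hne => ?_) fun h => (h hτ).elim
      have h1 : ((τ : ℂ) - i) * (K i).eval (τ : ℂ) = 0 := by
        have := hS τ hτ
        rw [(hK i hi).1] at this
        simpa using this
      have h2 : (τ : ℂ) - i ≠ 0 := sub_ne_zero.2 fun h => hne (Circle.ext h.symm)
      rw [eval_mul, (mul_eq_zero.1 h1).resolve_left h2, mul_zero]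
    rw [hP, eval_add, eval_finsetSum, hsum, hU τ hτ]
    simp only [eval_mul, eval_add, eval_C, eval_X, (hK τ hτ).2]
    ring
  have hZ0 : ∀ z : ℂ, (∀ τ ∈ S, z ≠ τ) → Z.eval z ≠ 0 := fun z hz => by
    rw [hZ, eval_prod]
    exact Finset.prod_ne_zero_iff.2 fun τ hτ => by simpa [sub_eq_zero] using hz τ hτ
  have hZS : ∀ τ ∈ S, Z.eval (τ : ℂ) = 0 := fun τ hτ => by
    rw [hZ, eval_prod]
    exact Finset.prod_eq_zero hτ (by simp)
  have hH₁0 : ∀ z : ℂ, ‖z‖ ≤ 1 → H₁.eval z ≠ 0 := by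
    intro z hz h0
    by_cases hzS : ∀ τ ∈ S, z ≠ τ
    · exact hH z hz hzS (by rw [hH₁, eval_mul, h0, mul_zero])
    · push Not at hzS
      obtain ⟨τ, hτ, rfl⟩ := hzS
      refine hS' τ hτ ?_
      rw [hH₁, derivative_mul, eval_add, eval_mul, eval_mul, h0, hZS τ hτ]
      ring
  set G : ℂ → ℂ := fun z => P₁.eval z / H₁.eval z with hG
  have hGd : DiffContOnCl ℂ G (Metric.ball 0 1) := by
    refine DifferentiableOn.diffContOnCl ?_
    rw [closure_ball _ one_ne_zero]
    exact P₁.differentiable.differentiableOn.div H₁.differentiable.differentiableOn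
      fun z hz => hH₁0 z (by simpa using hz)
  have hGre : ∀ z : ℂ, ‖z‖ ≤ 1 → (∀ τ ∈ S, z ≠ τ) →
      (G z).re = (U.eval z / H.eval z).re - ∑ τ ∈ S, c τ * diskKernel z τ := by
    intro z hz hzS
    have h1 : G z = P.eval z / H.eval z := by
      rw [hP₁, hH₁, eval_mul, eval_mul, mul_div_mul_left _ _ (hZ0 z hzS)]
    have h2 : ∀ τ ∈ S, (C (c τ : ℂ) * (X + C (τ : ℂ)) * K τ).eval z / H.eval z =
        -((c τ : ℂ) * ((τ + z) / (τ - z))) := by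
      intro τ hτ
      have h3 := hH z hz hzS
      have h4 : H.eval z = (z - τ) * (K τ).eval z := by
        conv_lhs => rw [(hK τ hτ).1]
        simp
      rw [h4] at h3 ⊢
      have h5 := left_ne_zero_of_mul h3
      have h6 := right_ne_zero_of_mul h3
      have h7 : (τ : ℂ) - z ≠ 0 := by rw [← neg_sub]; exact neg_ne_zero.2 h5
      simp only [eval_mul, eval_add, eval_C, eval_X]
      field_simp
      ring
    rw [h1, hP, eval_add, add_div, eval_finsetSum, Finset.sum_div, Finset.sum_congr rfl h2,
      Complex.add_re, Complex.re_sum, sub_eq_add_neg, ← Finset.sum_neg_distrib]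
    congr 1
    refine Finset.sum_congr rfl fun τ _ => ?_
    rw [Complex.neg_re, Complex.re_ofReal_mul, diskKernel_eq_re]
  -- Off `S` the subtracted terms have zero real part on the circle, and the finite set `S` is null.
  have hae : (fun ζ : Circle => (G ζ).re) =ᵐ[circleMeasure] w := by
    have h0 : ∀ᵐ ζ ∂circleMeasure, ζ ∉ S :=
      measure_eq_zero_iff_ae_notMem.1 (S.finite_toSet.measure_zero circleMeasure)
    filter_upwards [h0] with ζ hζ
    rw [hw ζ hζ, hGre ζ (Circle.norm_coe ζ).le fun τ hτ h => hζ (Circle.ext h ▸ hτ)]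
    simp [diskKernel, Circle.norm_coe]
  refine ⟨Integrable.congr (integrable_of_continuous _
    (Complex.continuous_re.comp (continuous_of_diffContOnCl hGd))) hae, fun z hz => ?_⟩
  have h1 := integral_diskKernel_mul_re hGd hz
  have h2 : ∫ ζ, diskKernel z ζ * w ζ ∂circleMeasure =
      ∫ ζ : Circle, diskKernel z ζ * (G ζ).re ∂circleMeasure := by
    refine integral_congr_ae ?_
    filter_upwards [hae] with ζ hζ
    rw [← hζ]
  rw [h2, h1, hGre z hz.le fun τ _ h => Circle.coe_sub_ne_zero hz τ (by rw [h, sub_self])]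
  ring

/-! ### Uniqueness through Fourier coefficients. -/

theorem conj_coe_circle (ζ : Circle) : conj (ζ : ℂ) = (ζ : ℂ)⁻¹ := by
  rw [← Circle.coe_inv, Circle.coe_inv_eq_conj]

theorem norm_ofReal_mul_circle_lt {r : ℝ} (hr0 : 0 < r) (hr1 : r < 1) (ξ : Circle) :
    ‖(r : ℂ) * ξ‖ < 1 := by
  rwa [norm_mul, Circle.norm_coe, mul_one, Complex.norm_real, Real.norm_of_nonneg hr0.le]

/-- This allows integration over the direction of the interior point with the boundary point fixed.
-/
theorem diskKernel_symm (r : ℝ) (ξ ζ : Circle) :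
    diskKernel (r * ξ) ζ = diskKernel (r * ζ) ξ := by
  have h1 : ‖(ζ : ℂ) - r * ξ‖ = ‖(ξ : ℂ) - r * ζ‖ := by
    have hξ := Circle.coe_mul_conj ξ
    have hζ := Circle.coe_mul_conj ζ
    calc ‖(ζ : ℂ) - r * ξ‖ = ‖(ξ : ℂ) * ζ * conj ((ξ : ℂ) - r * ζ)‖ := by
          congr 1
          simp only [map_sub, map_mul, Complex.conj_ofReal]
          linear_combination (-(ζ : ℂ)) * hξ + (r * ξ : ℂ) * hζ
      _ = _ := by rw [norm_mul, norm_mul, Circle.norm_coe, Circle.norm_coe, Complex.norm_conj,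
        one_mul, one_mul]
  rw [diskKernel, diskKernel, h1, norm_mul, norm_mul, Circle.norm_coe, Circle.norm_coe]

theorem integral_diskKernel_mul_zpow {r : ℝ} (hr0 : 0 < r) (hr1 : r < 1) (ζ : Circle) (j : ℤ) :
    ∫ ξ : Circle, (diskKernel (r * ξ) ζ : ℂ) * ((ξ ^ j : Circle) : ℂ) ∂circleMeasure =
      (r : ℂ) ^ j.natAbs * ((ζ ^ j : Circle) : ℂ) := by
  have hnat : ∀ k : ℕ, ∫ ξ : Circle, (diskKernel (r * ζ) ξ : ℂ) * (ξ : ℂ) ^ k ∂circleMeasure =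
      (r : ℂ) ^ k * (ζ : ℂ) ^ k := fun k => by
    have := integral_diskKernel_mul (G := fun z => z ^ k)
      (Differentiable.diffContOnCl (by fun_prop)) (norm_ofReal_mul_circle_lt hr0 hr1 ζ)
    rw [this, mul_pow]
  simp only [diskKernel_symm r _ ζ]
  obtain ⟨k, rfl | rfl⟩ := j.eq_nat_or_neg
  · simpa using hnat k
  · have h1 := congrArg conj (hnat k)
    rw [← integral_conj] at h1
    simp only [map_mul, map_pow, Complex.conj_ofReal] at h1
    simpa [conj_coe_circle] using h1

/-- The moments of a finite measure on `𝕋²` are determined by its Poisson integral. -/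
theorem integral_zpow_mul_zpow (σ : Measure (Circle × Circle)) [IsFiniteMeasure σ] {r : ℝ}
    (hr0 : 0 < r) (hr1 : r < 1) (j k : ℤ) :
    (r : ℂ) ^ j.natAbs * (r : ℂ) ^ k.natAbs *
        ∫ ζ, ((ζ.1 ^ j : Circle) : ℂ) * ((ζ.2 ^ k : Circle) : ℂ) ∂σ =
      ∫ ξ : Circle × Circle, ((∫ ζ, poissonKernel (r * ξ.1, r * ξ.2) ζ ∂σ : ℝ) : ℂ) *
        (((ξ.1 ^ j : Circle) : ℂ) * ((ξ.2 ^ k : Circle) : ℂ))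
          ∂(circleMeasure.prod circleMeasure) := by
  let Φ : Circle × Circle → Circle × Circle → ℂ := fun ξ ζ =>
    ((diskKernel (r * ξ.1) ζ.1 : ℂ) * ((ξ.1 ^ j : Circle) : ℂ)) *
      ((diskKernel (r * ξ.2) ζ.2 : ℂ) * ((ξ.2 ^ k : Circle) : ℂ))
  have hcont : Continuous (Function.uncurry Φ) := by
    have h1 : Continuous fun x : (Circle × Circle) × (Circle × Circle) =>
        diskKernel (r * x.1.1) x.2.1 := continuous_diskKernel (by fun_prop) (by fun_prop)
          fun x => norm_ofReal_mul_circle_lt hr0 hr1 _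
    have h2 : Continuous fun x : (Circle × Circle) × (Circle × Circle) =>
        diskKernel (r * x.1.2) x.2.2 := continuous_diskKernel (by fun_prop) (by fun_prop)
          fun x => norm_ofReal_mul_circle_lt hr0 hr1 _
    have hcoe : Continuous fun ζ : Circle => (ζ : ℂ) := by fun_prop
    have h3 : Continuous fun x : (Circle × Circle) × (Circle × Circle) =>
        ((x.1.1 ^ j : Circle) : ℂ) :=
      hcoe.comp (Continuous.zpow (continuous_fst.comp continuous_fst) j)
    have h4 : Continuous fun x : (Circle × Circle) × (Circle × Circle) =>
        ((x.1.2 ^ k : Circle) : ℂ) :=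
      hcoe.comp (Continuous.zpow (continuous_snd.comp continuous_fst) k)
    exact ((Complex.continuous_ofReal.comp h1).mul h3).mul
      ((Complex.continuous_ofReal.comp h2).mul h4)
  have hswap := integral_integral_swap
    (integrable_of_continuous ((circleMeasure.prod circleMeasure).prod σ) hcont)
  have hleft : ∀ ζ : Circle × Circle, ∫ ξ, Φ ξ ζ ∂(circleMeasure.prod circleMeasure) =
      (r : ℂ) ^ j.natAbs * (r : ℂ) ^ k.natAbs *
        (((ζ.1 ^ j : Circle) : ℂ) * ((ζ.2 ^ k : Circle) : ℂ)) := fun ζ => by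
    rw [integral_prod_mul (fun x : Circle => (diskKernel (r * x) ζ.1 : ℂ) * ((x ^ j : Circle) : ℂ))
      fun y : Circle => (diskKernel (r * y) ζ.2 : ℂ) * ((y ^ k : Circle) : ℂ),
      integral_diskKernel_mul_zpow hr0 hr1, integral_diskKernel_mul_zpow hr0 hr1]
    ring
  have hright : ∀ ξ : Circle × Circle, ∫ ζ, Φ ξ ζ ∂σ =
      ((∫ ζ, poissonKernel (r * ξ.1, r * ξ.2) ζ ∂σ : ℝ) : ℂ) *
        (((ξ.1 ^ j : Circle) : ℂ) * ((ξ.2 ^ k : Circle) : ℂ)) := fun ξ => by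
    rw [← integral_complex_ofReal, ← integral_mul_const]
    refine integral_congr_ae (Eventually.of_forall fun ζ => ?_)
    simp only [Φ, poissonKernel_eq_mul, Complex.ofReal_mul]
    ring
  simp only [hleft, hright, integral_const_mul] at hswap
  exact hswap.symm

/-- A finite measure on `𝕋²` is determined by its moments. -/
theorem ext_of_integral_zpow_mul_zpow {σ σ' : Measure (Circle × Circle)} [IsFiniteMeasure σ]
    [IsFiniteMeasure σ']
    (h : ∀ j k : ℤ, ∫ ζ, ((ζ.1 ^ j : Circle) : ℂ) * ((ζ.2 ^ k : Circle) : ℂ) ∂σ =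
      ∫ ζ, ((ζ.1 ^ j : Circle) : ℂ) * ((ζ.2 ^ k : Circle) : ℂ) ∂σ') : σ = σ' := by
  let f₁ : BoundedContinuousFunction (Circle × Circle) ℂ :=
    BoundedContinuousFunction.mkOfCompact ⟨fun ζ => (ζ.1 : ℂ), by fun_prop⟩
  let f₂ : BoundedContinuousFunction (Circle × Circle) ℂ :=
    BoundedContinuousFunction.mkOfCompact ⟨fun ζ => (ζ.2 : ℂ), by fun_prop⟩
  let A : StarSubalgebra ℂ (BoundedContinuousFunction (Circle × Circle) ℂ) :=
    StarAlgebra.adjoin ℂ {f₁, f₂}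
  have hA : (A.map (BoundedContinuousFunction.toContinuousMapStarₐ ℂ)).SeparatesPoints := by
    intro x y hxy
    by_cases h1 : x.1 = y.1
    · have h2 : x.2 ≠ y.2 := fun h2 => hxy (Prod.ext h1 h2)
      exact ⟨f₂, ⟨f₂.toContinuousMapStarₐ ℂ,
        ⟨f₂, StarAlgebra.subset_adjoin ℂ _ (by simp), rfl⟩, rfl⟩, fun h => h2 (Circle.ext h)⟩
    · exact ⟨f₁, ⟨f₁.toContinuousMapStarₐ ℂ,
        ⟨f₁, StarAlgebra.subset_adjoin ℂ _ (by simp), rfl⟩, rfl⟩, fun h => h1 (Circle.ext h)⟩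
  refine ext_of_forall_mem_subalgebra_integral_eq_of_polish hA fun g hg => ?_
  -- On the circle conjugation is inversion, so the generators and their adjoints multiply out to
  -- monomials with integer exponents.
  have hmono : ∀ g ∈ Submonoid.closure ({f₁, f₂} ∪ star {f₁, f₂}), ∃ j k : ℤ,
      ∀ ζ : Circle × Circle, g ζ = ((ζ.1 ^ j : Circle) : ℂ) * ((ζ.2 ^ k : Circle) : ℂ) := by
    intro g hg
    induction hg using Submonoid.closure_induction with
    | mem g hg =>
      rcases hg with (rfl | rfl) | hg
      · exact ⟨1, 0, fun ζ => by simp [f₁]⟩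
      · exact ⟨0, 1, fun ζ => by simp [f₂]⟩
      · rw [Set.mem_star] at hg
        rcases hg with hg | hg
        · refine ⟨-1, 0, fun ζ => ?_⟩
          rw [← star_star g, hg]
          simp [f₁, conj_coe_circle]
        · refine ⟨0, -1, fun ζ => ?_⟩
          rw [← star_star g, Set.mem_singleton_iff.1 hg]
          simp [f₂, conj_coe_circle]
    | one => exact ⟨0, 0, fun ζ => by simp⟩
    | mul a b _ _ ha hb =>
      obtain ⟨j, k, ha⟩ := ha
      obtain ⟨j', k', hb⟩ := hb
      refine ⟨j + j', k + k', fun ζ => ?_⟩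
      rw [BoundedContinuousFunction.mul_apply, ha, hb, zpow_add, zpow_add, Circle.coe_mul,
        Circle.coe_mul]
      ring
  have hg' : g ∈ Submodule.span ℂ
      (Submonoid.closure ({f₁, f₂} ∪ star {f₁, f₂}) : Set _) := by
    rw [← StarAlgebra.adjoin_eq_span]
    exact hg
  clear hg
  induction hg' using Submodule.span_induction with
  | mem g hg =>
    obtain ⟨j, k, hjk⟩ := hmono g hg
    simp only [hjk]
    exact h j k
  | zero => simp
  | add a b _ _ ha hb =>
    simp only [BoundedContinuousFunction.add_apply]
    rw [integral_add (a.integrable σ) (b.integrable σ),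
      integral_add (a.integrable σ') (b.integrable σ'), ha, hb]
  | smul c a _ ha =>
    simp only [BoundedContinuousFunction.smul_apply]
    rw [integral_smul, integral_smul, ha]

/-- The Poisson integral on a single torus of radius `r` in `(0, 1)` already determines all moments;
`r = 1/2` is an arbitrary choice. -/
theorem IsClarkMeasure.unique {φ : ℂ × ℂ → ℂ} {α : Circle} {σ σ' : Measure (Circle × Circle)}
    (h : IsClarkMeasure φ α σ) (h' : IsClarkMeasure φ α σ') : σ = σ' := by
  have := h.1
  have := h'.1
  have hr0 : (0 : ℝ) < 1 / 2 := by norm_num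
  have hr1 : (1 / 2 : ℝ) < 1 := by norm_num
  refine ext_of_integral_zpow_mul_zpow fun j k => ?_
  have h1 := integral_zpow_mul_zpow σ hr0 hr1 j k
  have h2 := integral_zpow_mul_zpow σ' hr0 hr1 j k
  have h3 : ∀ ξ : Circle × Circle,
      ∫ ζ, poissonKernel (((1 / 2 : ℝ) : ℂ) * ξ.1, ((1 / 2 : ℝ) : ℂ) * ξ.2) ζ ∂σ =
        ∫ ζ, poissonKernel (((1 / 2 : ℝ) : ℂ) * ξ.1, ((1 / 2 : ℝ) : ℂ) * ξ.2) ζ ∂σ' := fun ξ => by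
    have n1 := norm_ofReal_mul_circle_lt hr0 hr1 ξ.1
    have n2 := norm_ofReal_mul_circle_lt hr0 hr1 ξ.2
    rw [← h.2 _ n1 n2, ← h'.2 _ n1 n2]
  simp only [h3] at h1
  refine mul_left_cancel₀ ?_ (h1.trans h2.symm)
  have : ((1 / 2 : ℝ) : ℂ) ≠ 0 := by norm_num
  positivity

/-! ### The candidate measure and its integrals. -/

/-- The sum of the image of `ν` on the graph of `g` and of multiples `c k` of the Lebesgue measures
on the circles `{τ k} × 𝕋`. -/
def graphMeasure {m : ℕ} (ν : Measure Circle) (g : Circle → Circle) (τ : Fin m → Circle)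
    (c : Fin m → ℝ) : Measure (Circle × Circle) :=
  ν.map (fun ζ => (ζ, g ζ)) +
    ∑ k, ENNReal.ofReal (c k) • circleMeasure.map (fun ζ => (τ k, ζ))

section graphMeasure

variable {m : ℕ} {ν : Measure Circle} {g : Circle → Circle} {τ : Fin m → Circle} {c : Fin m → ℝ}

theorem isFiniteMeasure_graphMeasure [IsFiniteMeasure ν] :
    IsFiniteMeasure (graphMeasure ν g τ c) := by
  have : ∀ k, IsFiniteMeasure
      (ENNReal.ofReal (c k) • circleMeasure.map (fun ζ => (τ k, ζ))) := fun k =>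
    Measure.smul_finite _ ENNReal.ofReal_ne_top
  unfold graphMeasure
  infer_instance

variable {E : Type*} [NormedAddCommGroup E] {f : Circle × Circle → E}

theorem integrable_graph (hg : Continuous g) (hf : Integrable f (graphMeasure ν g τ c)) :
    Integrable (fun ζ => f (ζ, g ζ)) ν := by
  have h := (integrable_add_measure.1 hf).1
  exact h.comp_measurable (by fun_prop)

theorem integrable_fiber (hf : Integrable f (graphMeasure ν g τ c)) {k : Fin m} (hk : 0 < c k) :
    Integrable f (circleMeasure.map fun ζ => (τ k, ζ)) := by
  have h := integrable_finsetSum_measure.1 (integrable_add_measure.1 hf).2 k (Finset.mem_univ k)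
  exact (integrable_smul_measure (by simpa using hk) ENNReal.ofReal_ne_top).1 h

theorem integral_graphMeasure [NormedSpace ℝ E] (hg : Continuous g) (hc : ∀ k, 0 ≤ c k)
    (hf : Integrable f (graphMeasure ν g τ c)) :
    ∫ ζ, f ζ ∂(graphMeasure ν g τ c) =
      ∫ ζ, f (ζ, g ζ) ∂ν + ∑ k, c k • ∫ ζ, f (τ k, ζ) ∂circleMeasure := by
  obtain ⟨h1, h2⟩ := integrable_add_measure.1 hf
  rw [graphMeasure, integral_add_measure h1 h2,
    integral_map (by fun_prop) h1.aestronglyMeasurable,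
    integral_finsetSum_measure (integrable_finsetSum_measure.1 h2)]
  congr 1
  refine Finset.sum_congr rfl fun k _ => ?_
  rw [integral_smul_measure, ENNReal.toReal_ofReal (hc k)]
  rcases (hc k).eq_or_lt with h0 | h0
  -- When `c k = 0`, `f` may fail to be integrable on the circle; both terms are zero regardless.
  · rw [← h0, zero_smul, zero_smul]
  · rw [integral_map (by fun_prop) (integrable_fiber hf h0).aestronglyMeasurable]

end graphMeasure

/-! ### The Poisson formula in the first variable. -/

section poissonFormula

variable {n : ℕ} {p : ℂ[X][Y]}

/-- Since `|N| = |D|` on the circle, `N` vanishes too, and the defect is `p₁ N + p₂ D`. -/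
theorem IsRIFDenominator.eq_of_bDen_eval_eq_zero (hp : IsRIFDenominator n p) {α ζ : Circle}
    (h : (bDen n p α).eval (ζ : ℂ) = 0) :
    (reflection n (p.coeff 0)).eval (ζ : ℂ) = α * (p.coeff 1).eval (ζ : ℂ) ∧
      (defect n p).eval (ζ : ℂ) = 0 := by
  have h1 : (bNum n p α).eval (ζ : ℂ) = 0 := by
    rw [← norm_eq_zero, ← hp.norm_bDen_eval, h, norm_zero]
  simp only [bDen, bNum, eval_sub, eval_mul, eval_C] at h h1
  refine ⟨sub_eq_zero.1 h1, ?_⟩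
  simp only [defect, eval_sub, eval_mul]
  linear_combination (p.coeff 0).eval (ζ : ℂ) * h1 + (p.coeff 1).eval (ζ : ℂ) * h

theorem IsSingularity.bDen_eval_eq_zero_iff (hp : IsRIFDenominator n p) {τ lam β : Circle} {s : ℝ}
    (h : IsSingularity n p τ lam β s) (α : Circle) :
    (bDen n p α).eval (τ : ℂ) = 0 ↔ β = α := by
  refine ⟨fun h0 => ?_, ?_⟩
  · have h1 := (hp.eq_of_bDen_eval_eq_zero h0).1
    rw [h.reflection_coeff_zero] at h1
    exact Circle.ext (mul_right_cancel₀ h.coeff_one_ne_zero h1)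
  · rintro rfl
    simp [bDen, h.reflection_coeff_one]

/-- The boundary values of `Re ((α + φ) / (α - φ))` in the first variable. -/
theorem wAlpha_mul_diskKernel (hp : IsRIFDenominator n p) {α ζ : Circle} {b : Circle} {z₂ : ℂ}
    (hD : (bDen n p α).eval (ζ : ℂ) ≠ 0)
    (hb : conj (b : ℂ) = (bNum n p α).eval (ζ : ℂ) / (bDen n p α).eval (ζ : ℂ)) :
    wAlpha n p α ζ * diskKernel z₂ b =
      ((α * p.evalEval (ζ : ℂ) z₂ + (biReflection n p).evalEval (ζ : ℂ) z₂) /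
        (α * p.evalEval (ζ : ℂ) z₂ - (biReflection n p).evalEval (ζ : ℂ) z₂)).re := by
  have hN : (bNum n p α).eval (ζ : ℂ) = conj (b : ℂ) * (bDen n p α).eval (ζ : ℂ) := by
    rw [hb, div_mul_cancel₀ _ hD]
  have hH : α * p.evalEval (ζ : ℂ) z₂ - (biReflection n p).evalEval (ζ : ℂ) z₂ =
      (bDen n p α).eval (ζ : ℂ) - z₂ * (bNum n p α).eval (ζ : ℂ) := by
    rw [hp.evalEval_eq, evalEval_biReflection, bDen, bNum]
    simp only [eval_sub, eval_mul, eval_C]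
    ring
  -- `|D - z₂ N| = |D| |1 - z₂ b̄| = |N| |b - z₂|`, as `b` is unimodular.
  have hHn : ‖α * p.evalEval (ζ : ℂ) z₂ - (biReflection n p).evalEval (ζ : ℂ) z₂‖ =
      ‖(bNum n p α).eval (ζ : ℂ)‖ * ‖(b : ℂ) - z₂‖ := by
    have hbb := Circle.coe_mul_conj b
    have h1 : (b : ℂ) - z₂ = b * (1 - z₂ * conj (b : ℂ)) := by linear_combination z₂ * hbb
    rw [hH, ← hp.norm_bDen_eval, h1, norm_mul, Circle.norm_coe, one_mul, ← norm_mul, hN]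
    congr 1
    ring
  have hnum : ‖(α : ℂ) * p.evalEval (ζ : ℂ) z₂‖ ^ 2 - ‖(biReflection n p).evalEval (ζ : ℂ) z₂‖ ^ 2 =
      (‖(p.coeff 0).eval (ζ : ℂ)‖ ^ 2 - ‖(p.coeff 1).eval (ζ : ℂ)‖ ^ 2) * (1 - ‖z₂‖ ^ 2) := by
    rw [hp.evalEval_eq, evalEval_biReflection, eval_reflection (hp.natDegree_coeff_le 0),
      eval_reflection (hp.natDegree_coeff_le 1), norm_mul, Circle.norm_coe, one_mul,
      mul_left_comm z₂, ← mul_add, norm_mul, norm_pow, Circle.norm_coe, one_pow, one_mul]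
    simp only [Complex.sq_norm, Complex.normSq_apply, Complex.add_re, Complex.add_im,
      Complex.mul_re, Complex.mul_im, Complex.conj_re, Complex.conj_im]
    ring
  have hN' : (reflection n (p.coeff 0)).eval (ζ : ℂ) - (α : ℂ) * (p.coeff 1).eval (ζ : ℂ) =
      (bNum n p α).eval (ζ : ℂ) := by simp [bNum]
  rw [re_add_div_sub, hnum, hHn, wAlpha, hN', diskKernel, mul_pow, div_mul_div_comm]

/-- The Poisson formula for `Re ((α + φ) / (α - φ))` in the first variable, at a fixed value of the
second. -/
theorem poisson_formula_rif [DecidableEq Circle] (hp : IsRIFDenominator n p) (α : Circle)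
    {S : Finset Circle}
    (hS : ∀ ζ, ζ ∈ S ↔ (defect n p).eval (ζ : ℂ) = 0) {lam β : Circle → Circle} {s : Circle → ℝ}
    (hsing : ∀ τ ∈ S, IsSingularity n p τ (lam τ) (β τ) (s τ)) {g : Circle → Circle}
    (hg : ∀ ζ : Circle, (bDen n p α).eval (ζ : ℂ) ≠ 0 →
      conj (g ζ : ℂ) = (bNum n p α).eval (ζ : ℂ) / (bDen n p α).eval (ζ : ℂ))
    {z₂ : ℂ} (hz₂ : ‖z₂‖ < 1) :
    Integrable (fun ζ => wAlpha n p α ζ * diskKernel z₂ (g ζ)) circleMeasure ∧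
      ∀ z₁ : ℂ, ‖z₁‖ < 1 →
        (((α : ℂ) + rif n p (z₁, z₂)) / ((α : ℂ) - rif n p (z₁, z₂))).re =
          ∫ ζ, diskKernel z₁ ζ * (wAlpha n p α ζ * diskKernel z₂ (g ζ)) ∂circleMeasure +
            ∑ τ ∈ S with β τ = α, (s τ)⁻¹ * diskKernel z₁ τ := by
  set U : ℂ[X] := C (α : ℂ) * (p.coeff 0 + C z₂ * p.coeff 1) +
    (reflection n (p.coeff 1) + C z₂ * reflection n (p.coeff 0)) with hU
  set H : ℂ[X] := C (α : ℂ) * (p.coeff 0 + C z₂ * p.coeff 1) -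
    (reflection n (p.coeff 1) + C z₂ * reflection n (p.coeff 0)) with hH
  have hUe : ∀ z : ℂ, U.eval z = α * p.evalEval z z₂ + (biReflection n p).evalEval z z₂ :=
    fun z => by simp [hU, hp.evalEval_eq, evalEval_biReflection]
  have hHe : ∀ z : ℂ, H.eval z = α * p.evalEval z z₂ - (biReflection n p).evalEval z z₂ :=
    fun z => by simp [hH, hp.evalEval_eq, evalEval_biReflection]
  have hHD : ∀ z : ℂ, H.eval z = (bDen n p α).eval z - z₂ * (bNum n p α).eval z := fun z => by
    simp only [hH, bDen, bNum, eval_sub, eval_mul, eval_C, eval_add]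
    ring
  have hDS : ∀ ζ : Circle, (bDen n p α).eval (ζ : ℂ) = 0 ↔ ζ ∈ S ∧ β ζ = α := by
    intro ζ
    refine ⟨fun h => ?_, fun h => ((hsing ζ h.1).bDen_eval_eq_zero_iff hp α).2 h.2⟩
    have hζ := (hS ζ).2 (hp.eq_of_bDen_eval_eq_zero h).2
    exact ⟨hζ, ((hsing ζ hζ).bDen_eval_eq_zero_iff hp α).1 h⟩
  have hder : ∀ τ ∈ S, β τ = α → (derivative H).eval (τ : ℂ) = -(s τ * α * conj (τ : ℂ) *
      ((p.coeff 0).eval (τ : ℂ) + z₂ * (p.coeff 1).eval (τ : ℂ))) := by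
    intro τ hτ hβ
    have h0 := (hsing τ hτ).derivative_coeff_zero
    have h1 := (hsing τ hτ).derivative_coeff_one
    rw [hβ] at h0 h1
    simp only [hH, derivative_sub, derivative_add, derivative_C_mul, eval_sub, eval_add, eval_mul,
      eval_C]
    linear_combination -h1 - z₂ * h0
  have hne : ∀ τ ∈ S, (p.coeff 0).eval (τ : ℂ) + z₂ * (p.coeff 1).eval (τ : ℂ) ≠ 0 := by
    intro τ hτ
    refine evalEval_ne_zero_of_ne (hsing τ hτ) fun h => ?_
    rw [h, Circle.norm_coe] at hz₂
    exact lt_irrefl _ hz₂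
  -- At such a `τ`, `U = 2 α p(τ, z₂)` and `H' = -s α τ̄ p(τ, z₂)`. The factor `p(τ, z₂)` drops out
  -- of the residue, leaving the mass `s⁻¹` for every `z₂`.
  have key := poisson_formula_of_simple_poles (U := U) (H := H) (S := S.filter fun τ => β τ = α)
    (c := fun τ => (s τ)⁻¹) (w := fun ζ => wAlpha n p α ζ * diskKernel z₂ (g ζ)) ?_ ?_ ?_ ?_ ?_
  · refine ⟨key.1, fun z₁ hz₁ => ?_⟩
    rw [← key.2 z₁ hz₁, hUe, hHe]
    have hp0 := hp.evalEval_ne_zero z₁ z₂ hz₁ hz₂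
    simp only [rif]
    rw [add_div' _ _ _ hp0, sub_div' hp0, div_div_div_cancel_right₀ hp0]
  · intro z hz hzS
    rw [hHD]
    refine hp.bDen_sub_mul_bNum_ne_zero α hz hz₂ fun h => ?_
    rcases hz.lt_or_eq with hlt | heq
    · exact hp.bDen_eval_ne_zero α hlt h
    · refine hzS ⟨z, by simpa [Submonoid.unitSphere] using heq⟩ (Finset.mem_filter.2 ?_) rfl
      exact (hDS _).1 h
  · intro τ hτ
    have h1 := (hDS τ).2 (Finset.mem_filter.1 hτ)
    have h2 := hp.norm_bDen_eval α τ
    rw [h1, norm_zero, eq_comm, norm_eq_zero] at h2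
    rw [hHD, h1, h2, mul_zero, sub_zero]
  · intro τ hτ
    obtain ⟨hτ, hβ⟩ := Finset.mem_filter.1 hτ
    rw [hder τ hτ hβ]
    have := (hsing τ hτ).pos.ne'
    have hτ0 := Circle.coe_ne_zero τ
    have hα0 := Circle.coe_ne_zero α
    simpa [hτ0, hα0, this] using hne τ hτ
  · intro τ hτ
    obtain ⟨hτ, hβ⟩ := Finset.mem_filter.1 hτ
    have hs : ((s τ : ℝ) : ℂ) ≠ 0 := by exact_mod_cast (hsing τ hτ).pos.ne'
    have hττ := Circle.coe_mul_conj τ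
    have h0 := (hsing τ hτ).reflection_coeff_zero
    have h1 := (hsing τ hτ).reflection_coeff_one
    rw [hβ] at h0 h1
    rw [hder τ hτ hβ]
    simp only [hU, eval_add, eval_mul, eval_C, h0, h1, Complex.ofReal_inv]
    field_simp
    linear_combination (-2 * ((p.coeff 0).eval (τ : ℂ) + z₂ * (p.coeff 1).eval (τ : ℂ))) * hττ
  · intro ζ hζ
    have hD : (bDen n p α).eval (ζ : ℂ) ≠ 0 := fun h => hζ (Finset.mem_filter.2 ((hDS ζ).1 h))
    rw [hUe, hHe, ← wAlpha_mul_diskKernel hp hD (hg ζ hD)]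

end poissonFormula

/-! ### Identification of the Clark measure. -/

variable {n : ℕ} {p : ℂ[X][Y]}

theorem measurable_wAlpha (n : ℕ) (p : ℂ[X][Y]) (α : Circle) : Measurable (wAlpha n p α) := by
  have h : ∀ q : ℂ[X], Measurable fun ζ : Circle => q.eval (ζ : ℂ) := fun q =>
    (q.continuous.comp (by fun_prop : Continuous fun ζ : Circle => (ζ : ℂ))).measurable
  have h0 := h (p.coeff 0)
  have h1 := h (p.coeff 1)
  have h2 := h (reflection n (p.coeff 0))
  unfold wAlpha
  fun_prop

theorem integral_nuAlpha (hp : IsRIFDenominator n p) (α : Circle) (f : Circle → ℝ) :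
    ∫ ζ, f ζ ∂(nuAlpha n p α) = ∫ ζ, wAlpha n p α ζ * f ζ ∂circleMeasure := by
  rw [nuAlpha, integral_withDensity_eq_integral_toReal_smul
    (measurable_wAlpha n p α).ennreal_ofReal (Eventually.of_forall fun _ => ENNReal.ofReal_lt_top)]
  simp only [ENNReal.toReal_ofReal (hp.wAlpha_nonneg α _), smul_eq_mul]

theorem isClarkMeasure_graphMeasure [DecidableEq Circle] (hp : IsRIFDenominator n p) (α : Circle)
    {S : Finset Circle} (hS : ∀ ζ, ζ ∈ S ↔ (defect n p).eval (ζ : ℂ) = 0)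
    {lam β : Circle → Circle} {s : Circle → ℝ}
    (hsing : ∀ τ ∈ S, IsSingularity n p τ (lam τ) (β τ) (s τ)) {g : Circle → Circle}
    (hgc : Continuous g)
    (hg : ∀ ζ : Circle, (bDen n p α).eval (ζ : ℂ) ≠ 0 →
      conj (g ζ : ℂ) = (bNum n p α).eval (ζ : ℂ) / (bDen n p α).eval (ζ : ℂ))
    {m : ℕ} (e : Fin m ≃ S) :
    IsClarkMeasure (rif n p) α (graphMeasure (nuAlpha n p α) g (fun k => (e k : Circle))
      fun k => if β (e k) = α then (s (e k))⁻¹ else 0) := by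
  have hc0 : ∀ k, 0 ≤ if β (e k) = α then (s (e k))⁻¹ else 0 := fun k => by
    split_ifs
    · exact inv_nonneg.2 (hsing _ (e k).2).pos.le
    · exact le_rfl
  have hfin : IsFiniteMeasure (nuAlpha n p α) := by
    -- At `z₂ = 0` the kernel is identically one, so the formula's integrability clause is that of
    -- `W_α`.
    have h := (poisson_formula_rif hp α hS hsing hg (z₂ := 0) (by simp)).1
    simp only [diskKernel, sub_zero, Circle.norm_coe, norm_zero] at h
    norm_num at h
    exact isFiniteMeasure_withDensity_ofReal h.2
  have hσ : IsFiniteMeasure (graphMeasure (nuAlpha n p α) g (fun k => (e k : Circle))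
      fun k => if β (e k) = α then (s (e k))⁻¹ else 0) := isFiniteMeasure_graphMeasure
  refine ⟨hσ, fun z hz₁ hz₂ => ?_⟩
  have hcont : Continuous (poissonKernel z) := by
    have h1 : Continuous fun ζ : Circle × Circle => diskKernel z.1 ζ.1 :=
      continuous_diskKernel continuous_const continuous_fst fun _ => hz₁
    have h2 : Continuous fun ζ : Circle × Circle => diskKernel z.2 ζ.2 :=
      continuous_diskKernel continuous_const continuous_snd fun _ => hz₂
    exact (h1.mul h2).congr fun ζ => (poissonKernel_eq_mul z ζ).symm
  rw [(poisson_formula_rif hp α hS hsing hg hz₂).2 z.1 hz₁,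
    integral_graphMeasure hgc hc0 (integrable_of_continuous _ hcont), integral_nuAlpha hp]
  simp only [poissonKernel_eq_mul, integral_const_mul, integral_diskKernel hz₂, mul_one]
  congr 1
  · refine integral_congr_ae (Eventually.of_forall fun ζ => ?_)
    ring
  · rw [Finset.sum_filter, ← Finset.sum_coe_sort S, ← e.sum_comp]
    refine Finset.sum_congr rfl fun k _ => ?_
    split_ifs <;> simp

end ClarkRIF

end

theorem theorem1p2 (n : ℕ) (hn : 1 ≤ n) (p : ℂ[X][Y]) (hp : ClarkRIF.IsRIFDenominator n p)
    (α : Circle) :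
    -- the singularities `(τ k, lam k)`, i.e. the zeros of `p` on `𝕋²`; their number is at most `n`
    ∃ (m : ℕ) (τ lam : Fin m → Circle),
      m ≤ n ∧
      Function.Injective (fun k => (τ k, lam k)) ∧
      Set.range (fun k => (τ k, lam k)) = ClarkRIF.boundaryZeros p ∧
      -- the non-tangential value of `φ` exists and is unimodular at each singularity
      (∀ k, ∃ β : Circle, ClarkRIF.HasNontangentialValue (ClarkRIF.rif n p) (τ k, lam k) β) ∧
      ClarkRIF.IsFiniteBlaschkeProduct (ClarkRIF.bAlpha n p α) ∧
      (∀ ζ, 0 ≤ ClarkRIF.wAlpha n p α ζ) ∧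
      -- `g ζ` is the conjugate of `B_α ζ`
      ∃ g : Circle → Circle,
        (∀ ζ : Circle,
          (g ζ : ℂ) = conj ((ClarkRIF.bAlpha n p α).eval (RingHom.id ℂ) (ζ : ℂ))) ∧
        -- `σ` is the unique Clark measure
        ∃ σ : Measure (Circle × Circle),
          ClarkRIF.IsClarkMeasure (ClarkRIF.rif n p) α σ ∧
          (∀ σ', ClarkRIF.IsClarkMeasure (ClarkRIF.rif n p) α σ' → σ' = σ) ∧
          ∃ c : Fin m → ℝ,
            (∀ k, 0 ≤ c k) ∧
            (∀ k, 0 < c k ↔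
              ClarkRIF.HasNontangentialValue (ClarkRIF.rif n p) (τ k, lam k) α) ∧
            (∀ k, ClarkRIF.HasNontangentialValue (ClarkRIF.rif n p) (τ k, lam k) α →
              ∀ z₂ : ℂ, ‖z₂‖ ≤ 1 → z₂ ≠ lam k →
                c k = 1 / ‖deriv (fun z₁ : ℂ => ClarkRIF.rif n p (z₁, z₂)) (τ k)‖) ∧
            ∀ f : Circle × Circle → ℂ, Integrable f σ →
              Integrable (fun ζ => f (ζ, g ζ)) (ClarkRIF.nuAlpha n p α) ∧
              (∀ k, 0 < c k → Integrable (fun ζ => f (τ k, ζ)) ClarkRIF.circleMeasure) ∧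
              ∫ ζ, f ζ ∂σ =
                ∫ ζ, f (ζ, g ζ) ∂(ClarkRIF.nuAlpha n p α) +
                  ∑ k, (c k : ℂ) * ∫ ζ, f (τ k, ζ) ∂ClarkRIF.circleMeasure := by
  classical
  obtain ⟨S, hScard, hS⟩ := hp.exists_finset_defect_roots
  have hex : ∀ τ : Circle, ∃ (lam β : Circle) (s : ℝ), τ ∈ S →
      ClarkRIF.IsSingularity n p τ lam β s := fun τ => by
    by_cases hτ : τ ∈ S
    · obtain ⟨lam, β, s, h⟩ := hp.exists_isSingularity ((hS τ).1 hτ)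
      exact ⟨lam, β, s, fun _ => h⟩
    · exact ⟨1, 1, 0, fun h => (hτ h).elim⟩
  choose lam β s hsing using hex
  let e : Fin S.card ≃ S := S.equivFin.symm
  have hB := hp.isFiniteBlaschkeProduct_bAlpha α
  obtain ⟨b, hbc, hb⟩ := hB.exists_continuous
  have hk : ∀ k, ClarkRIF.IsSingularity n p (e k) (lam (e k)) (β (e k)) (s (e k)) :=
    fun k => hsing _ (e k).2
  -- The inverse of a unimodular number is its conjugate. Cancelling common factors makes `B_α`
  -- continuous on the whole circle, including the zeros of `D`.
  have hgc : Continuous fun ζ => (b ζ)⁻¹ := hbc.inv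
  have hg : ∀ ζ : Circle, (ClarkRIF.bDen n p α).eval (ζ : ℂ) ≠ 0 →
      conj (((b ζ)⁻¹ : Circle) : ℂ) =
        (ClarkRIF.bNum n p α).eval (ζ : ℂ) / (ClarkRIF.bDen n p α).eval (ζ : ℂ) := by
    intro ζ hD
    rw [Circle.coe_inv_eq_conj, Complex.conj_conj, hb]
    exact RatFunc.eval_algebraMap_div_algebraMap _ _ hD
  have hpos : ∀ k, (0 < if β (e k) = α then (s (e k))⁻¹ else 0) ↔ β (e k) = α := fun k => by
    split_ifs with h
    · simpa [h] using (hk k).pos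
    · simp [h]
  have hc0 : ∀ k, 0 ≤ if β (e k) = α then (s (e k))⁻¹ else 0 := fun k => by
    split_ifs
    · exact inv_nonneg.2 (hk k).pos.le
    · exact le_rfl
  have hclark := ClarkRIF.isClarkMeasure_graphMeasure hp α hS hsing hgc hg e
  refine ⟨S.card, fun k => e k, fun k => lam (e k), hScard, fun i j hij => ?_, ?_,
    fun k => ⟨β (e k), ClarkRIF.hasNontangentialValue_rif hp (hk k)⟩, hB, hp.wAlpha_nonneg α,
    fun ζ => (b ζ)⁻¹, fun ζ => by rw [Circle.coe_inv_eq_conj, hb], _, hclark,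
    fun σ' h => h.unique hclark, fun k => if β (e k) = α then (s (e k))⁻¹ else 0, hc0,
    fun k => ?_, fun k h z₂ _ hz₂ => ?_, fun f hf => ⟨?_, fun k h => ?_, ?_⟩⟩
  · exact e.injective (Subtype.ext (Prod.ext_iff.1 hij).1)
  · ext ⟨ζ₁, ζ₂⟩
    refine ⟨?_, fun h => ?_⟩
    · rintro ⟨k, hk'⟩
      obtain ⟨rfl, rfl⟩ := Prod.ext_iff.1 hk'
      exact (ClarkRIF.mem_boundaryZeros_iff hp (hk k) _).2 rfl
    · have hmem := (hS ζ₁).2 (ClarkRIF.defect_eval_eq_zero_of_mem_boundaryZeros hp h)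
      refine ⟨e.symm ⟨ζ₁, hmem⟩, ?_⟩
      have h2 := (ClarkRIF.mem_boundaryZeros_iff hp (hsing ζ₁ hmem) ζ₂).1 h
      simp [h2]
  · rw [ClarkRIF.hasNontangentialValue_rif_iff hp (hk k)]
    exact hpos k
  · rw [ClarkRIF.hasNontangentialValue_rif_iff hp (hk k)] at h
    change (if β (e k) = α then (s (e k))⁻¹ else 0) =
      1 / ‖deriv (fun z₁ : ℂ => ClarkRIF.rif n p (z₁, z₂)) ((e k : Circle) : ℂ)‖
    rw [if_pos h, ClarkRIF.deriv_rif hp (hk k) hz₂, norm_mul, norm_mul, Complex.norm_conj,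
      Circle.norm_coe, Circle.norm_coe, Complex.norm_real, Real.norm_of_nonneg (hk k).pos.le]
    simp
  · exact ClarkRIF.integrable_graph hgc hf
  · exact (ClarkRIF.integrable_fiber hf h).comp_measurable (by fun_prop)
  · rw [ClarkRIF.integral_graphMeasure hgc hc0 hf]
    simp only [Complex.real_smul]
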